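/- Let $\Sigma$ be a compact connected Riemann surface with a smooth Hermitian metric with area form $\omega_\Sigma$ and area $\mathrm{Vol}(\Sigma)$. Let $S^1=\mathbb R/T\mathbb Z$ be the circle of length $T>0$ with coordinate $t$, and give $S^1\times\Sigma$ the product metric and the orientation $dt\wedge\omega_\Sigma$. Let $p_j=(t_j,z_j)\in S^1\times\Sigma$, $j=1,\dots,N$, be distinct points with $0<t_j<T$, let $n\ge 1$, and let $\vec k_j=(k_{j1},\dots,k_{jn})\in\mathbb Z^n$, $\operatorname{tr}(\vec k_j)=\sum_m k_{jm}$. Let $E$ be a Hermitian vector bundle of rank $n$ on $(S^1\times\Sigma)\setminus\{p_1,\dots,p_N\}$ with a unitary connection $\nabla$ of curvature $F_\nabla$ and a skew-Hermitian section $\phi$ of $\mathrm{End}(E)$ (all smooth). The triple $(E,\nabla,\phi)$ is a *singular $U(n)$ HE-monopole with constant $C\in\mathbb R$* if $$F_\nabla-iC\,\mathrm{id}_E\,\omega_\Sigma=*\nabla\phi$$ and if it has at each $p_j$ a singularity of Dirac type with weight $\vec k_j$; it is a *singular $U(n)$ monopole* if instead $F_\nabla=*\nabla\phi$, with the same condition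 at the $p_j$. Dirac type with weight $(k_1,\dots,k_n)$ at $p=(t_0,z_0)$ means the following. Let $w$ be a holomorphic coordinate of $\Sigma$ centred at $z_0$ with $|dw|=1$ at $z_0$, and let $(R,\theta,\psi)$ be the spherical coordinates with $t-t_0=R\cos\theta$, $w=R\sin\theta\,e^{i\psi}$. Then, on some ball $R<c$, there are unitary trivialisations of $E$ over $\{\theta\ne0\}$ and over $\{\theta\neq\pi\}$, with transition function $\mathrm{diag}(e^{ik_1\psi},\dots,e^{ik_n\psi})$ from the first to the second, in both of which, as $R\to0$, $$\phi=\frac{i}{2R}\,\mathrm{diag}(k_1,\dots,k_n)+O(1),\qquad \nabla(R\phi)=O(1).$$ Denote by $c_1(E|_{\{0\}\times\Sigma})$ the first Chern number of the restriction of $E$ to $\{0\}\times\Sigma$, that is, $\frac{i}{2\pi}\int_\Sigma \operatorname{tr}F$ for the curvature $F$ of any unitary connection on this restriction. 1. If $(E,\nabla,\phi)$ is a singular $U(n)$ monopole, then $$\sum_{j=1}^N \operatorname{tr}(\vec k_j)\,t_j = c_1(E|_{\{0\}\times\Sigma})\,T .$$ 2. If $(E,\nabla,\phi)$ is a singular $U(n)$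 HE-monopole with constant $C$, then $$\sum_{j=1}^N \operatorname{tr}(\vec k_j)\,t_j = T\Bigl(c_1(E|_{\{0\}\times\Sigma})+\frac{Cn}{2\pi}\mathrm{Vol}(\Sigma)\Bigr),$$ and hence $C$ is determined by the positions (and weights) of the singularities and the degree of $E$ on $\{0\}\times\Sigma$: $$C=-\frac{2\pi}{\mathrm{Vol}(\Sigma)}\cdot\frac{1}{n}\Bigl(c_1(E|_{\{0\}\times\Sigma})-\frac1T\sum_{j=1}^N \operatorname{tr}(\vec k_j)\,t_j\Bigr).$$ -/

import Mathlib

open scoped Manifold ContDiff Matrix.Norms.L2Operator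

noncomputable section

namespace SingularMonopole

/-- Complex `n × n` matrices; they carry the operator norm for the Euclidean norm on `ℂⁿ`, which is invariant
under unitary conjugation. -/
abbrev Mat (n : ℕ) : Type := Matrix (Fin n) (Fin n) ℂ

/-! ### Coordinates -/

/-- A system of local coordinates on `B`, with index type `κ` and model space `V`: for each `k : κ`,
a parametrization `param k` of an open piece of `B`, defined on `dom k ⊆ V`. Tangent spaces of `B`
are copies of `V`, and `diff k v` is the differential of `param k` at `v`. -/
structure Coords (κ V B : Type*) [NormedAddCommGroup V] [NormedSpace ℝ V] where
  dom : κ → Set V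
  param : κ → V → B
  diff : κ → V → V →L[ℝ] V

/-- The part of the coordinate domain `k` that is sent into `W ⊆ B`. -/
def Coords.over {κ V B : Type*} [NormedAddCommGroup V] [NormedSpace ℝ V] (P : Coords κ V B)
    (k : κ) (W : Set B) : Set V :=
  {v | v ∈ P.dom k ∧ P.param k v ∈ W}

/-- The holomorphic coordinates of a Riemann surface (all charts of the maximal atlas). -/
abbrev HolChart (S : Type*) [TopologicalSpace S] [ChartedSpace ℂ S] : Type _ :=
  {e : OpenPartialHomeomorph S ℂ // e ∈ IsManifold.maximalAtlas 𝓘(ℂ) ω S}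

/-- The chart that the charted space structure chooses at `x`. -/
def HolChart.at {S : Type*} [TopologicalSpace S] [ChartedSpace ℂ S] [IsManifold 𝓘(ℂ) ω S] (x : S) :
    HolChart S :=
  ⟨chartAt ℂ x, IsManifold.chart_mem_maximalAtlas x⟩

/-- Differential at `w` of the inverse `e⁻¹` of a holomorphic coordinate, as a real linear map
from `ℂ` to the tangent space of the surface at `e⁻¹ w` (which Mathlib models on `ℂ`). -/
def HolChart.diffSymm {S : Type*} [TopologicalSpace S] [ChartedSpace ℂ S]
    (e : HolChart S) (w : ℂ) : ℂ →L[ℝ] ℂ :=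
  mfderiv 𝓘(ℝ, ℂ) 𝓘(ℝ, ℂ) e.1.symm w

/-- Coordinates on a Riemann surface: `w ↦ e⁻¹ w`. -/
def surfaceCoords (S : Type*) [TopologicalSpace S] [ChartedSpace ℂ S] :
    Coords (HolChart S) ℂ S where
  dom e := e.1.target
  param e := e.1.symm
  diff e w := e.diffSymm w

/-- Coordinates on the product of the circle `ℝ / Tℤ` of length `T` with a Riemann surface:
`(t, w) ↦ (t mod T, e⁻¹ w)`. -/
def productCoords (T : ℝ) (S : Type*) [TopologicalSpace S] [ChartedSpace ℂ S] :
    Coords (HolChart S) (ℝ × ℂ) (AddCircle T × S) where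
  dom e := {q | q.2 ∈ e.1.target}
  param e q := ((q.1 : AddCircle T), e.1.symm q.2)
  diff e q := (ContinuousLinearMap.id ℝ ℝ).prodMap (e.diffSymm q.2)

/-! ### Hermitian metrics on a Riemann surface -/

/-- A smooth Hermitian metric on a Riemann surface: in each holomorphic coordinate `w` it is
`density w * |dw|²`, with the usual transformation rule. -/
structure HermitianMetric (S : Type*) [TopologicalSpace S] [ChartedSpace ℂ S] where
  density : HolChart S → ℂ → ℝ
  density_pos : ∀ e : HolChart S, ∀ w ∈ e.1.target, 0 < density e w
  density_smooth : ∀ e : HolChart S, ContDiffOn ℝ ∞ (density e) e.1.target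
  density_transform : ∀ e e' : HolChart S, ∀ w ∈ (e.1.symm.trans e'.1).source,
    density e w = density e' (e'.1 (e.1.symm w)) * ‖deriv (fun u => e'.1 (e.1.symm u)) w‖ ^ 2

section Area

variable {S : Type*} [TopologicalSpace S] [ChartedSpace ℂ S] [MeasurableSpace S]

/-- The area measure `density * dx dy` carried by the source of one holomorphic coordinate. -/
def HermitianMetric.chartArea (g : HermitianMetric S) (e : HolChart S) : MeasureTheory.Measure S :=
  MeasureTheory.Measure.map e.1.symm
    ((MeasureTheory.volume.restrict e.1.target).withDensity
      fun w => ENNReal.ofReal (g.density e w))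

/-- The area measure: the measure that restricts to `chartArea e` on the source of each holomorphic
coordinate `e`, that is, the least measure above all of these. -/
def HermitianMetric.area (g : HermitianMetric S) : MeasureTheory.Measure S :=
  ⨆ e : HolChart S, g.chartArea e

/-- The volume (area) of the surface. -/
def HermitianMetric.vol (g : HermitianMetric S) : ℝ :=
  g.area.real Set.univ

end Area

/-! ### Unitary bundles, connections, Higgs fields, in local unitary frames -/

section Bundles

variable {κ V B : Type*} [NormedAddCommGroup V] [NormedSpace ℝ V] [TopologicalSpace B]

/-- A smooth Hermitian vector bundle of rank `n` over the open set `Y ⊆ B`, given by unitary frames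
over the sets `U a` of an open cover of `Y`, with smooth transition functions `g a b` with values in
`U(n)`. The components of a section `σ` in these frames satisfy `σ_a = g_ab σ_b`. -/
structure HermitianBundle (P : Coords κ V B) (Y : Set B) (ι : Type*) (n : ℕ) where
  U : ι → Set B
  isOpen_U : ∀ a, IsOpen (U a)
  iUnion_U : ⋃ a, U a = Y
  g : ι → ι → B → Mat n
  g_unitary : ∀ a b, ∀ p ∈ U a ∩ U b, g a b p ∈ Matrix.unitaryGroup (Fin n) ℂ
  g_cocycle : ∀ a b c, ∀ p ∈ U a ∩ U b ∩ U c, g a b p * g b c p = g a c p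
  g_smooth : ∀ a b k, ContDiffOn ℝ ∞ (fun v => g a b (P.param k v)) (P.over k (U a ∩ U b))

/-- Coordinate expression, in the coordinates `k`, of a matrix valued one-form `α` on `B`. -/
def pullForm {n : ℕ} (P : Coords κ V B) (α : B → V →L[ℝ] Mat n) (k : κ) (v : V) : V →L[ℝ] Mat n :=
  (α (P.param k v)).comp (P.diff k v)

/-- A smooth unitary connection: `∇ = d + A a` in the frame `a`, where the connection matrices
`A a` are smooth one-forms with skew-Hermitian values, and
`A a = g_ab (A b) g_ab⁻¹ - (d g_ab) g_ab⁻¹` on `U a ∩ U b`. -/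
structure Connection {P : Coords κ V B} {Y : Set B} {ι : Type*} {n : ℕ}
    (E : HermitianBundle P Y ι n) where
  A : ι → B → V →L[ℝ] Mat n
  A_smooth : ∀ a k, ContDiffOn ℝ ∞ (pullForm P (A a) k) (P.over k (E.U a))
  A_skew : ∀ a, ∀ p ∈ E.U a, ∀ u : V, (A a p u).conjTranspose = -(A a p u)
  A_gauge : ∀ a b k, ∀ v ∈ P.over k (E.U a ∩ E.U b), ∀ u : V,
    pullForm P (A a) k v u =
      E.g a b (P.param k v) * pullForm P (A b) k v u * (E.g a b (P.param k v)).conjTranspose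
        - fderiv ℝ (fun v' => E.g a b (P.param k v')) v u * (E.g a b (P.param k v)).conjTranspose

/-- A Higgs field: a smooth skew-Hermitian section of `End E`. -/
structure HiggsField {P : Coords κ V B} {Y : Set B} {ι : Type*} {n : ℕ}
    (E : HermitianBundle P Y ι n) where
  φ : ι → B → Mat n
  φ_smooth : ∀ a k, ContDiffOn ℝ ∞ (fun v => φ a (P.param k v)) (P.over k (E.U a))
  φ_skew : ∀ a, ∀ p ∈ E.U a, (φ a p).conjTranspose = -(φ a p)
  φ_gauge : ∀ a b, ∀ p ∈ E.U a ∩ E.U b,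
    φ a p = E.g a b p * φ b p * (E.g a b p).conjTranspose

/-- Curvature `F = dA + A ∧ A` of a connection matrix in coordinates, on the vectors `u`, `u'`. -/
def curvature {n : ℕ} (A : V → V →L[ℝ] Mat n) (v u u' : V) : Mat n :=
  fderiv ℝ A v u u' - fderiv ℝ A v u' u + (A v u * A v u' - A v u' * A v u)

/-- Covariant derivative `∇_u ψ = dψ(u) + [A(u), ψ]` of a section of `End E`, in a frame and in
coordinates. -/
def covDeriv {n : ℕ} (A : V → V →L[ℝ] Mat n) (ψ : V → Mat n) (v u : V) : Mat n :=
  fderiv ℝ ψ v u + (A v u * ψ v - ψ v * A v u)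

end Bundles

/-! ### The first Chern number of a Hermitian bundle over a compact Riemann surface -/

section Chern

variable {S : Type*} [TopologicalSpace S] [ChartedSpace ℂ S] [IsManifold 𝓘(ℂ) ω S]
  {ι : Type*} {n : ℕ}

/-- A local frame of a bundle over the whole surface, defined near `x`. -/
def frameAt (E : HermitianBundle (surfaceCoords S) Set.univ ι n) (x : S) : ι :=
  Classical.choose (Set.mem_iUnion.mp (E.iUnion_U.symm ▸ Set.mem_univ x : x ∈ ⋃ a, E.U a))

/-- The function `f` on the surface such that `tr F = f • (area form)`, where `F` is the curvature
of the connection `D`; it does not depend on the frame and the coordinate used to compute it. -/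
def traceCurvature {E : HermitianBundle (surfaceCoords S) Set.univ ι n} (g : HermitianMetric S)
    (D : Connection E) (x : S) : ℂ :=
  (curvature (pullForm (surfaceCoords S) (D.A (frameAt E x)) (HolChart.at x))
      ((HolChart.at x).1 x) 1 Complex.I).trace
    / (g.density (HolChart.at x) ((HolChart.at x).1 x) : ℂ)

/-- The Chern-Weil integral `(i / 2π) ∫_S tr F` of a unitary connection. -/
def chernIntegral [MeasurableSpace S] {E : HermitianBundle (surfaceCoords S) Set.univ ι n}
    (g : HermitianMetric S) (D : Connection E) : ℝ :=
  (Complex.I / (2 * Real.pi) * ∫ x, traceCurvature g D x ∂g.area).re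

open Classical in
/-- The first Chern number `c₁(E)` of a Hermitian bundle over a compact Riemann surface, by
Chern-Weil theory: the integral `(i / 2π) ∫_S tr F` for an arbitrary unitary connection on `E`.
(The metric `g` only serves to turn two-forms into functions.) -/
def firstChernNumber [MeasurableSpace S] (g : HermitianMetric S)
    (E : HermitianBundle (surfaceCoords S) Set.univ ι n) : ℝ :=
  if h : Nonempty (Connection E) then chernIntegral g h.some else 0

end Chern

/-! ### The punctured three-manifold -/

section ThreeManifold

variable {T : ℝ} {S : Type*}

/-- The complement in `S¹ × S` of the points `p_j = (t_j, z_j)`. -/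
def puncturedProduct (T : ℝ) {N : ℕ} (t : Fin N → ℝ) (z : Fin N → S) : Set (AddCircle T × S) :=
  {p | ∀ j, p ≠ ((t j : AddCircle T), z j)}

/-- If all `t_j` lie strictly between `0` and `T`, the slice `{0} × S` avoids the punctures. -/
theorem zero_slice_mem {N : ℕ} {t : Fin N → ℝ} (ht : ∀ j, t j ∈ Set.Ioo 0 T) (z : Fin N → S)
    (x : S) : ((0 : AddCircle T), x) ∈ puncturedProduct T t z := by
  intro j h
  have hT : 0 < T := (ht j).1.trans (ht j).2
  have h0 : ((t j : ℝ) : AddCircle T) = 0 := (congrArg Prod.fst h).symm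
  obtain ⟨m, hm⟩ := (AddCircle.coe_eq_zero_of_pos_iff T hT (ht j).1).mp h0
  have h1 := (ht j).1
  have h2 := (ht j).2
  rw [← hm, nsmul_eq_mul] at h1 h2
  have h3 : (0 : ℝ) < m := by
    by_contra hneg
    exact absurd h1 (not_lt.mpr (mul_nonpos_of_nonpos_of_nonneg (not_lt.mp hneg) hT.le))
  have h4 : (1 : ℝ) ≤ m := by exact_mod_cast h3
  nlinarith

variable [TopologicalSpace S] [ChartedSpace ℂ S] {ι : Type*} {n : ℕ}

/-- The restriction of a bundle over `Y ⊆ S¹ × S` to the slice `{0} × S`. -/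
def HermitianBundle.zeroSlice {Y : Set (AddCircle T × S)}
    (E : HermitianBundle (productCoords T S) Y ι n) (hY : ∀ x : S, ((0 : AddCircle T), x) ∈ Y) :
    HermitianBundle (surfaceCoords S) Set.univ ι n where
  U a := {x | ((0 : AddCircle T), x) ∈ E.U a}
  isOpen_U a := (E.isOpen_U a).preimage (by fun_prop)
  iUnion_U := by
    ext x
    have h := hY x
    rw [← E.iUnion_U] at h
    simpa using h
  g a b x := E.g a b (0, x)
  g_unitary a b x hx := E.g_unitary a b (0, x) hx
  g_cocycle a b c x hx := E.g_cocycle a b c (0, x) hx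
  g_smooth a b e := by
    have h := (E.g_smooth a b e).comp (s := (surfaceCoords S).over e
        ({x | ((0 : AddCircle T), x) ∈ E.U a} ∩ {x | ((0 : AddCircle T), x) ∈ E.U b}))
      (f := fun w : ℂ => ((0 : ℝ), w)) (contDiff_const.prodMk contDiff_id).contDiffOn
      (fun w hw => ⟨hw.1, hw.2⟩)
    exact h

/-! ### The Bogomolny equations -/

/-- The area form `ω = density * dx ∧ dy` of the surface, pulled back to `S¹ × S`, in coordinates. -/
def areaForm (density : ℝ) (u u' : ℝ × ℂ) : ℝ :=
  density * (u.2.re * u'.2.im - u.2.im * u'.2.re)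

/-- The Hodge star of a one-form `α` for the metric `dt² + density * (dx² + dy²)` and the
orientation `dt ∧ dx ∧ dy`: `*dt = density * dx ∧ dy`, `*dx = dy ∧ dt`, `*dy = dt ∧ dx`. -/
def hodgeStar (density : ℝ) (α : ℝ × ℂ → Mat n) (u u' : ℝ × ℂ) : Mat n :=
  (density * (u.2.re * u'.2.im - u.2.im * u'.2.re)) • α (1, 0)
    + (u.2.im * u'.1 - u.1 * u'.2.im) • α (0, 1)
    + (u.1 * u'.2.re - u.2.re * u'.1) • α (0, Complex.I)

/-- The Hermitian-Einstein-Bogomolny equation `F - i C id_E ω = * ∇φ`. -/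
def HEBogomolny {Y : Set (AddCircle T × S)} {E : HermitianBundle (productCoords T S) Y ι n}
    (g : HermitianMetric S) (C : ℝ) (D : Connection E) (Φ : HiggsField E) : Prop :=
  ∀ (a : ι) (e : HolChart S), ∀ q ∈ (productCoords T S).over e (E.U a), ∀ u u' : ℝ × ℂ,
    curvature (pullForm (productCoords T S) (D.A a) e) q u u'
        - (Complex.I * C * (areaForm (g.density e q.2) u u' : ℂ)) • (1 : Mat n)
      = hodgeStar (g.density e q.2)
          (covDeriv (pullForm (productCoords T S) (D.A a) e)
            (fun q' => Φ.φ a ((productCoords T S).param e q')) q) u u'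

/-- The Bogomolny equation `F = * ∇φ`. -/
def Bogomolny {Y : Set (AddCircle T × S)} {E : HermitianBundle (productCoords T S) Y ι n}
    (g : HermitianMetric S) (D : Connection E) (Φ : HiggsField E) : Prop :=
  ∀ (a : ι) (e : HolChart S), ∀ q ∈ (productCoords T S).over e (E.U a), ∀ u u' : ℝ × ℂ,
    curvature (pullForm (productCoords T S) (D.A a) e) q u u'
      = hodgeStar (g.density e q.2)
          (covDeriv (pullForm (productCoords T S) (D.A a) e)
            (fun q' => Φ.φ a ((productCoords T S).param e q')) q) u u'

/-! ### Singularities of Dirac type -/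

/-- Euclidean distance of the coordinates `q = (t, x + iy)` from `(t₀, 0)`. -/
def radius (t₀ : ℝ) (q : ℝ × ℂ) : ℝ :=
  Real.sqrt ((q.1 - t₀) ^ 2 + ‖q.2‖ ^ 2)

/-- The punctured ball `0 < R < c` about `(t₀, 0)`. -/
def puncturedBall (t₀ c : ℝ) : Set (ℝ × ℂ) :=
  {q | 0 < radius t₀ q ∧ radius t₀ q < c}

/-- The part `θ ≠ 0` of the punctured ball (`θ` is the angle with the positive `t`-axis). -/
def ballZero (t₀ c : ℝ) : Set (ℝ × ℂ) :=
  {q ∈ puncturedBall t₀ c | ¬ (q.2 = 0 ∧ t₀ < q.1)}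

/-- The part `θ ≠ π` of the punctured ball. -/
def ballPi (t₀ c : ℝ) : Set (ℝ × ℂ) :=
  {q ∈ puncturedBall t₀ c | ¬ (q.2 = 0 ∧ q.1 < t₀)}

/-- A smooth unitary trivialisation of `E` over a set `W` of coordinates `e`: unitary matrices
`h a`, one for each frame `a` of `E`, such that a section with components `σ_a` in the frame `a`
has the components `h a σ_a` in the trivialisation. -/
structure IsTrivialisation {Y : Set (AddCircle T × S)}
    (E : HermitianBundle (productCoords T S) Y ι n) (e : HolChart S) (W : Set (ℝ × ℂ))
    (h : ι → ℝ × ℂ → Mat n) : Prop where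
  smooth : ∀ a, ContDiffOn ℝ ∞ (h a) (W ∩ (productCoords T S).over e (E.U a))
  unitary : ∀ a, ∀ q ∈ W ∩ (productCoords T S).over e (E.U a),
    h a q ∈ Matrix.unitaryGroup (Fin n) ℂ
  compatible : ∀ a b, ∀ q ∈ W ∩ (productCoords T S).over e (E.U a ∩ E.U b),
    h a q * E.g a b ((productCoords T S).param e q) = h b q

/-- `(E, ∇, φ)` has a singularity of Dirac type with weight `(k_1, …, k_n)` at the point
`(t₀, z₀)`. The coordinates are `t` and a holomorphic coordinate `w` centred at `z₀` with `|dw| = 1`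
at `z₀`, so that the metric is the Euclidean one up to `O(R)`. There are unitary trivialisations
over the parts `θ ≠ 0` and `θ ≠ π` of a punctured ball, with transition function
`diag (exp (i k_m ψ))` from the first to the second, `ψ` being the argument of `w`, in which
`φ = (i / 2R) diag (k_m) + O(1)`; and `∇(R φ) = O(1)`, a condition that is the same in every unitary
frame. -/
def DiracSingularity {Y : Set (AddCircle T × S)} {E : HermitianBundle (productCoords T S) Y ι n}
    (g : HermitianMetric S) (D : Connection E) (Φ : HiggsField E)
    (t₀ : ℝ) (z₀ : S) (k : Fin n → ℤ) : Prop :=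
  ∃ e : HolChart S, z₀ ∈ e.1.source ∧ e.1 z₀ = 0 ∧ g.density e 0 = 1 ∧
  ∃ c : ℝ, 0 < c ∧
    (∀ q ∈ puncturedBall t₀ c, q ∈ (productCoords T S).over e Y) ∧
  ∃ hZero hPi : ι → ℝ × ℂ → Mat n,
    IsTrivialisation E e (ballZero t₀ c) hZero ∧
    IsTrivialisation E e (ballPi t₀ c) hPi ∧
    (∀ a, ∀ q ∈ ballZero t₀ c ∩ ballPi t₀ c ∩ (productCoords T S).over e (E.U a),
      hPi a q = Matrix.diagonal (fun m => (q.2 / (‖q.2‖ : ℂ)) ^ k m) * hZero a q) ∧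
  ∃ M : ℝ,
    (∀ a, ∀ q ∈ ballZero t₀ c ∩ (productCoords T S).over e (E.U a),
      ‖hZero a q * Φ.φ a ((productCoords T S).param e q) * (hZero a q).conjTranspose
        - (Complex.I / (2 * radius t₀ q)) • Matrix.diagonal (fun m => (k m : ℂ))‖ ≤ M) ∧
    (∀ a, ∀ q ∈ ballPi t₀ c ∩ (productCoords T S).over e (E.U a),
      ‖hPi a q * Φ.φ a ((productCoords T S).param e q) * (hPi a q).conjTranspose
        - (Complex.I / (2 * radius t₀ q)) • Matrix.diagonal (fun m => (k m : ℂ))‖ ≤ M) ∧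
    (∀ a, ∀ q ∈ puncturedBall t₀ c ∩ (productCoords T S).over e (E.U a), ∀ u : ℝ × ℂ,
      ‖covDeriv (pullForm (productCoords T S) (D.A a) e)
        (fun q' => radius t₀ q' • Φ.φ a ((productCoords T S).param e q')) q u‖ ≤ M * ‖u‖)

/-- A singular `U(n)` Hermitian-Einstein monopole with constant `C`: a solution of the
HE-Bogomolny equation with singularities of Dirac type, of weight `k j` at `(t j, z j)`. -/
def IsHEMonopole {N : ℕ} {t : Fin N → ℝ} {z : Fin N → S}
    {E : HermitianBundle (productCoords T S) (puncturedProduct T t z) ι n}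
    (g : HermitianMetric S) (k : Fin N → Fin n → ℤ) (C : ℝ)
    (D : Connection E) (Φ : HiggsField E) : Prop :=
  HEBogomolny g C D Φ ∧ ∀ j, DiracSingularity g D Φ (t j) (z j) (k j)

/-- A singular `U(n)` monopole: a solution of the Bogomolny equation with singularities of Dirac
type, of weight `k j` at `(t j, z j)`. -/
def IsMonopole {N : ℕ} {t : Fin N → ℝ} {z : Fin N → S}
    {E : HermitianBundle (productCoords T S) (puncturedProduct T t z) ι n}
    (g : HermitianMetric S) (k : Fin N → Fin n → ℤ)
    (D : Connection E) (Φ : HiggsField E) : Prop :=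
  Bogomolny g D Φ ∧ ∀ j, DiracSingularity g D Φ (t j) (z j) (k j)

end ThreeManifold

end SingularMonopole

end

set_option linter.unusedSectionVars false

/-! Taking traces turns the equation into an abelian one. Commutators are traceless, so with `f = tr
φ` it reads `tr F - i C n ω = *df`. Both `tr F` and `ω` are closed, hence `d*df = 0`: `f` is
harmonic for the product metric away from the points `p_j`, where it behaves like `i κ_j / 2R` with
`κ_j = tr k_j`.

Lift `f` to a `T`-periodic function `h` on `ℝ × S` and put `p(s) = ∫_S (h - s ∂_s h)(s, ·)`. On a
slice without punctures `p'(s) = -s ∫ ∂_s² h`. By harmonicity `-∂_s² h` is the slice Laplacian, an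
exact two-form divided by the area form, so `p' = 0` by Stokes' theorem
(`SmoothOneForm.integral_curlDensity`, `IsPuncturedHarmonic.hasDerivAt_integral_legendre`). Thus `p`
is locally constant off the times `t_j`.

Across a puncture the integrand jumps by about `i κ_j t_j ε / R³`, whose integral over a small disc
tends to `2π i κ_j t_j` (`norm_dipole_jump_le`, `tendsto_setIntegral_of_near_dipole`,
`IsPuncturedHarmonic.tendsto_jump`). By `sub_eq_sum_jumps`, `p(T) - p(0) = 2π i ∑ κ_j t_j`.
Periodicity of `h` gives `p(T) - p(0) = -T ∫ ∂_s h(0, ·)`. The factor `s` in `p` is what makes the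
positions `t_j` appear.

On the slice `{0} × S` the traced equation says `tr F = (∂_s h + i C n) ω`
(`HEBogomolny.traceCurvature_zeroSlice`). Chern-Weil theory then expresses `∫ ∂_s h(0, ·)` through
`c₁`, `C` and the area; that the number does not depend on the connection is again Stokes' theorem,
applied to the trace of a difference of connections. The monopole case is `C = 0`. -/

noncomputable section

namespace SingularMonopole
open Set Filter Topology MeasureTheory

/-! ### Real smooth structure, holomorphic coordinate changes and one-forms on the surface. -/

section RealStructure

theorem contDiffGroupoid_complex_le_real :
    contDiffGroupoid ω 𝓘(ℂ) ≤ contDiffGroupoid ∞ 𝓘(ℝ, ℂ) := by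
  rw [contDiffGroupoid, contDiffGroupoid]
  apply groupoid_of_pregroupoid_le
  intro f s hfs
  exact (ContDiffOn.restrict_scalars ℝ hfs).of_le (by exact mod_cast le_top)

variable {S : Type*} [TopologicalSpace S] [ChartedSpace ℂ S]

/-- The real structure is what `mfderiv` in `HolChart.diffSymm` and the smooth partition of unity in
Stokes' theorem live on. -/
instance isManifold_real [IsManifold 𝓘(ℂ) ω S] : IsManifold 𝓘(ℝ, ℂ) ∞ S := by
  have : HasGroupoid S (contDiffGroupoid ∞ 𝓘(ℝ, ℂ)) :=
    hasGroupoid_of_le (G₁ := contDiffGroupoid ω 𝓘(ℂ)) inferInstance contDiffGroupoid_complex_le_real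
  exact IsManifold.mk' _ _ _

theorem HolChart.mem_real_maximalAtlas (e : HolChart S) :
    e.1 ∈ IsManifold.maximalAtlas 𝓘(ℝ, ℂ) ∞ S := by
  have h := e.2
  change e.1 ∈ (contDiffGroupoid ω 𝓘(ℂ)).maximalAtlas S at h
  change e.1 ∈ (contDiffGroupoid ∞ 𝓘(ℝ, ℂ)).maximalAtlas S
  rw [mem_maximalAtlas_iff] at h ⊢
  exact fun e' he' => ⟨contDiffGroupoid_complex_le_real (h e' he').1,
    contDiffGroupoid_complex_le_real (h e' he').2⟩

/-- The change of coordinates from `e` to `e'`. -/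
def HolChart.trans (e e' : HolChart S) (w : ℂ) : ℂ := e'.1 (e.1.symm w)

/-- The domain of the change of coordinates from `e` to `e'`. -/
def HolChart.overlap (e e' : HolChart S) : Set ℂ := (e.1.symm.trans e'.1).source

theorem HolChart.isOpen_overlap (e e' : HolChart S) : IsOpen (e.overlap e') :=
  (e.1.symm.trans e'.1).open_source

theorem HolChart.mem_overlap {e e' : HolChart S} {w : ℂ} :
    w ∈ e.overlap e' ↔ w ∈ e.1.target ∧ e.1.symm w ∈ e'.1.source := by
  simp [HolChart.overlap]

variable [IsManifold 𝓘(ℂ) ω S]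

theorem HolChart.contDiffOn_trans (e e' : HolChart S) :
    ContDiffOn ℂ ω (e.trans e') (e.overlap e') := by
  have h := (contDiffGroupoid ω 𝓘(ℂ)).compatible_of_mem_maximalAtlas e.2 e'.2
  rw [contDiffGroupoid, mem_groupoid_of_pregroupoid] at h
  have h1 := h.1
  simp only [contDiffPregroupoid, modelWithCornersSelf_coe, modelWithCornersSelf_coe_symm,
    Function.comp_id, Function.id_comp, range_id, inter_univ, preimage_id] at h1
  exact h1

theorem HolChart.differentiableAt_trans {e e' : HolChart S} {w : ℂ} (hw : w ∈ e.overlap e') :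
    DifferentiableAt ℂ (e.trans e') w :=
  ((e.contDiffOn_trans e').contDiffAt ((e.isOpen_overlap e').mem_nhds hw)).differentiableAt
    (by simp)

theorem HolChart.contDiffAt_trans {e e' : HolChart S} {w : ℂ} (hw : w ∈ e.overlap e') :
    ContDiffAt ℝ ∞ (e.trans e') w :=
  (((e.contDiffOn_trans e').contDiffAt ((e.isOpen_overlap e').mem_nhds hw)).restrict_scalars
    ℝ).of_le (by exact mod_cast le_top)

theorem HolChart.fderiv_trans_apply {e e' : HolChart S} {w : ℂ} (hw : w ∈ e.overlap e') (v : ℂ) :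
    fderiv ℝ (e.trans e') w v = deriv (e.trans e') w * v := by
  have h := (HolChart.differentiableAt_trans hw)
  rw [h.fderiv_restrictScalars ℝ]
  simp [mul_comm]

theorem HolChart.symm_trans {e e' : HolChart S} {w : ℂ} (hw : w ∈ e.overlap e') :
    e'.1.symm (e.trans e' w) = e.1.symm w :=
  e'.1.left_inv (HolChart.mem_overlap.mp hw).2

theorem HolChart.trans_mem_target {e e' : HolChart S} {w : ℂ} (hw : w ∈ e.overlap e') :
    e.trans e' w ∈ e'.1.target :=
  e'.1.map_source (HolChart.mem_overlap.mp hw).2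

/-- Chain rule for `e⁻¹ = e'⁻¹ ∘ (e' ∘ e⁻¹)`. It makes the coordinate expressions of one form on the
surface compatible with each other. -/
theorem HolChart.diffSymm_eq {e e' : HolChart S} {w : ℂ} (hw : w ∈ e.overlap e') :
    e.diffSymm w = (e'.diffSymm (e.trans e' w)).comp (fderiv ℝ (e.trans e') w) := by
  have h1 : (e.1.symm : ℂ → S) =ᶠ[𝓝 w] e'.1.symm ∘ e.trans e' := by
    filter_upwards [(e.isOpen_overlap e').mem_nhds hw] with v hv
    exact (HolChart.symm_trans hv).symm
  have h2 : MDifferentiableAt 𝓘(ℝ, ℂ) 𝓘(ℝ, ℂ) e'.1.symm (e.trans e' w) :=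
    ((contMDiffOn_symm_of_mem_maximalAtlas e'.mem_real_maximalAtlas).contMDiffAt
      (e'.1.open_target.mem_nhds (HolChart.trans_mem_target hw))).mdifferentiableAt (by simp)
  have h3 : MDifferentiableAt 𝓘(ℝ, ℂ) 𝓘(ℝ, ℂ) (e.trans e') w :=
    ((HolChart.contDiffAt_trans hw).differentiableAt (by simp)).mdifferentiableAt
  unfold HolChart.diffSymm
  rw [h1.mfderiv_eq, mfderiv_comp w h2 h3, mfderiv_eq_fderiv]
  rfl

/-- A smooth complex one-form on the surface, given in every holomorphic coordinate. -/
structure SmoothOneForm (S : Type*) [TopologicalSpace S] [ChartedSpace ℂ S] where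
  coord : HolChart S → ℂ → ℂ →L[ℝ] ℂ
  smooth : ∀ e : HolChart S, ContDiffOn ℝ ∞ (coord e) e.1.target
  compatible : ∀ e e' : HolChart S, ∀ w ∈ e.overlap e',
    coord e w = (coord e' (e.trans e' w)).comp (fderiv ℝ (e.trans e') w)

/-- The coefficient of `dx ∧ dy` in the exterior derivative of a one-form on `ℂ`. -/
def curl (β : ℂ → ℂ →L[ℝ] ℂ) (w : ℂ) : ℂ :=
  fderiv ℝ β w 1 Complex.I - fderiv ℝ β w Complex.I 1

/-- Multiplication by `a` on `ℂ = ℝ²` has real determinant `|a|²`, and an alternating form scales by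
the determinant. -/
theorem wedge_mul (A : ℂ →L[ℝ] ℂ →L[ℝ] ℂ) (a : ℂ) :
    A (a * 1) (a * Complex.I) - A (a * Complex.I) (a * 1) =
      ((‖a‖ ^ 2 : ℝ) : ℂ) * (A 1 Complex.I - A Complex.I 1) := by
  have e1 : a * 1 = a.re • (1 : ℂ) + a.im • Complex.I := by
    apply Complex.ext <;> simp
  have e2 : a * Complex.I = (-a.im) • (1 : ℂ) + a.re • Complex.I := by
    apply Complex.ext <;> simp
  rw [e1, e2, ← Complex.normSq_eq_norm_sq, Complex.normSq_apply]
  simp only [map_add, map_smul, add_apply, smul_apply]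
  simp only [Complex.real_smul]
  push_cast
  ring

theorem SmoothOneForm.contDiffAt (β : SmoothOneForm S) {e : HolChart S} {w : ℂ}
    (hw : w ∈ e.1.target) : ContDiffAt ℝ ∞ (β.coord e) w :=
  (β.smooth e).contDiffAt (e.1.open_target.mem_nhds hw)

theorem SmoothOneForm.differentiableAt (β : SmoothOneForm S) {e : HolChart S} {w : ℂ}
    (hw : w ∈ e.1.target) : DifferentiableAt ℝ (β.coord e) w :=
  (β.contDiffAt hw).differentiableAt (by simp)

/-- Exterior differentiation commutes with pullback: the second derivative of the coordinate change
drops out by symmetry. The remaining factor is the one by which the density of a Hermitian metric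
changes, so the quotient of curl and density is a function on the surface. -/
theorem SmoothOneForm.curl_trans (β : SmoothOneForm S) {e e' : HolChart S} {w : ℂ}
    (hw : w ∈ e.overlap e') :
    curl (β.coord e) w =
      ((‖deriv (e.trans e') w‖ ^ 2 : ℝ) : ℂ) * curl (β.coord e') (e.trans e' w) := by
  have h1 : β.coord e =ᶠ[𝓝 w]
      fun v => (β.coord e' (e.trans e' v)).comp (fderiv ℝ (e.trans e') v) := by
    filter_upwards [(e.isOpen_overlap e').mem_nhds hw] with v hv using β.compatible e e' v hv
  have hτ := HolChart.contDiffAt_trans hw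
  have h2 : DifferentiableAt ℝ (fun v => β.coord e' (e.trans e' v)) w :=
    (β.differentiableAt (HolChart.trans_mem_target hw)).comp w (hτ.differentiableAt (by simp))
  have h3 : DifferentiableAt ℝ (fderiv ℝ (e.trans e')) w :=
    (hτ.fderiv_right (m := 1) (by rw [one_add_one_eq_two]; exact ENat.LEInfty.out)).differentiableAt (by simp)
  have h4 : ∀ u v, fderiv ℝ (β.coord e) w u v =
      fderiv ℝ (β.coord e') (e.trans e' w) (deriv (e.trans e') w * u) (deriv (e.trans e') w * v)
        + β.coord e' (e.trans e' w) (fderiv ℝ (fderiv ℝ (e.trans e')) w u v) := by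
    intro u v
    rw [h1.fderiv_eq, fderiv_clm_comp h2 h3,
      show (fun v => β.coord e' (e.trans e' v)) = β.coord e' ∘ e.trans e' from rfl,
      fderiv_comp w (β.differentiableAt (HolChart.trans_mem_target hw))
        (hτ.differentiableAt (by simp))]
    simp [HolChart.fderiv_trans_apply hw, add_comm]
  have h5 : fderiv ℝ (fderiv ℝ (e.trans e')) w 1 Complex.I =
      fderiv ℝ (fderiv ℝ (e.trans e')) w Complex.I 1 :=
    (hτ.isSymmSndFDerivAt (by simpa using ENat.LEInfty.out)).eq _ _
  rw [curl, h4, h4, h5, add_sub_add_right_eq_sub, wedge_mul, curl]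

end RealStructure

/-! ### Smooth functions in holomorphic coordinates. -/

section Compact

variable {S : Type*} [TopologicalSpace S] [ChartedSpace ℂ S] [IsManifold 𝓘(ℂ) ω S]

theorem HolChart.contDiffOn_of_contMDiff {χ : S → ℝ} (hχ : ContMDiff 𝓘(ℝ, ℂ) 𝓘(ℝ) ∞ χ)
    (e : HolChart S) : ContDiffOn ℝ ∞ (χ ∘ e.1.symm) e.1.target :=
  contMDiffOn_iff_contDiffOn.mp
    (hχ.comp_contMDiffOn (contMDiffOn_symm_of_mem_maximalAtlas e.mem_real_maximalAtlas))

end Compact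

/-! ### The area measure. -/

section Area

variable {S : Type*} [TopologicalSpace S] [ChartedSpace ℂ S] [MeasurableSpace S] [BorelSpace S]

/-- The measure `density * dx dy` in a coordinate. -/
def HermitianMetric.coordArea (g : HermitianMetric S) (e : HolChart S) : Measure ℂ :=
  (volume.restrict e.1.target).withDensity fun w => ENNReal.ofReal (g.density e w)

variable (g : HermitianMetric S)

theorem HermitianMetric.coordArea_ac (e : HolChart S) :
    g.coordArea e ≪ volume.restrict e.1.target :=
  withDensity_absolutelyContinuous _ _

theorem HolChart.aemeasurable_symm (e : HolChart S) :
    AEMeasurable e.1.symm (volume.restrict e.1.target) :=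
  e.1.continuousOn_symm.aemeasurable e.1.open_target.measurableSet

theorem HermitianMetric.chartArea_apply (e : HolChart S) {A : Set S} (hA : MeasurableSet A) :
    g.chartArea e A =
      ∫⁻ w in e.1.target ∩ e.1.symm ⁻¹' A, ENNReal.ofReal (g.density e w) := by
  have h1 : NullMeasurableSet (e.1.symm ⁻¹' A) (volume.restrict e.1.target) :=
    e.aemeasurable_symm.nullMeasurable hA
  have h2 : AEMeasurable e.1.symm (g.coordArea e) := e.aemeasurable_symm.mono_ac (g.coordArea_ac e)
  rw [HermitianMetric.chartArea]
  refine (Measure.map_apply_of_aemeasurable h2 hA).trans ?_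
  rw [HermitianMetric.coordArea, withDensity_apply₀ _ h1,
    Measure.restrict_restrict₀ h1, inter_comm]

theorem HolChart.measurableSet_target_inter (e : HolChart S) {A : Set S} (hA : MeasurableSet A) :
    MeasurableSet (e.1.target ∩ e.1.symm ⁻¹' A) := by
  have h : Measurable fun w : e.1.target => e.1.symm w :=
    (continuousOn_iff_continuous_domRestrict.mp e.1.continuousOn_symm).measurable
  have h2 := e.1.open_target.measurableSet.subtype_image (h hA)
  have h3 : Subtype.val '' ((fun w : e.1.target => e.1.symm w) ⁻¹' A) =
      e.1.target ∩ e.1.symm ⁻¹' A := Subtype.image_preimage_coe _ (e.1.symm ⁻¹' A)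
  rwa [h3] at h2

variable [IsManifold 𝓘(ℂ) ω S]

/-- Change of variables: the Jacobian `|τ'|²` of the coordinate change `τ` is exactly the factor in
`density_transform`. -/
theorem HermitianMetric.chartArea_apply_eq (e e' : HolChart S) {A : Set S} (hA : MeasurableSet A)
    (h : A ⊆ e.1.source) (h' : A ⊆ e'.1.source) : g.chartArea e A = g.chartArea e' A := by
  rw [g.chartArea_apply e hA, g.chartArea_apply e' hA]
  have hB := e.measurableSet_target_inter hA
  have hsub : e.1.target ∩ e.1.symm ⁻¹' A ⊆ e.overlap e' := fun w hw =>
    HolChart.mem_overlap.mpr ⟨hw.1, h' hw.2⟩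
  have himage : e.trans e' '' (e.1.target ∩ e.1.symm ⁻¹' A) = e'.1.target ∩ e'.1.symm ⁻¹' A := by
    ext w
    constructor
    · rintro ⟨v, hv, rfl⟩
      refine ⟨HolChart.trans_mem_target (hsub hv), ?_⟩
      rw [mem_preimage, HolChart.symm_trans (hsub hv)]
      exact hv.2
    · intro hw
      refine ⟨e.1 (e'.1.symm w), ⟨e.1.map_source (h hw.2), ?_⟩, ?_⟩
      · rw [mem_preimage, e.1.left_inv (h hw.2)]
        exact hw.2
      · rw [HolChart.trans, e.1.left_inv (h hw.2), e'.1.right_inv hw.1]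
  have hinj : InjOn (e.trans e') (e.1.target ∩ e.1.symm ⁻¹' A) := by
    intro v hv w hw hvw
    have := congrArg e'.1.symm hvw
    rw [HolChart.symm_trans (hsub hv), HolChart.symm_trans (hsub hw)] at this
    exact e.1.symm.injOn hv.1 hw.1 this
  rw [← himage, lintegral_image_eq_lintegral_abs_det_fderiv_mul volume hB
    (fun w hw => ((HolChart.contDiffAt_trans (hsub hw)).differentiableAt
      (by simp)).hasFDerivAt.hasFDerivWithinAt) hinj]
  refine setLIntegral_congr_fun hB fun w hw => ?_
  have hdet : (fderiv ℝ (e.trans e') w).det = ‖deriv (e.trans e') w‖ ^ 2 := by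
    have h1 : (fderiv ℝ (e.trans e') w : ℂ →ₗ[ℝ] ℂ) =
        (deriv (e.trans e') w • (LinearMap.id : ℂ →ₗ[ℂ] ℂ)).restrictScalars ℝ := by
      ext v
      simp [HolChart.fderiv_trans_apply (hsub hw)]
    rw [ContinuousLinearMap.det, h1, LinearMap.det_restrictScalars, LinearMap.det_smul]
    simp [Algebra.norm_complex_apply, Complex.normSq_eq_norm_sq]
  rw [hdet, abs_of_nonneg (sq_nonneg _), ← ENNReal.ofReal_mul (sq_nonneg _),
    g.density_transform e e' w (hsub hw), mul_comm]
  rfl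

theorem HermitianMetric.chartArea_compl_source (e : HolChart S) :
    g.chartArea e e.1.sourceᶜ = 0 := by
  rw [g.chartArea_apply e e.1.open_source.measurableSet.compl]
  have : e.1.target ∩ e.1.symm ⁻¹' e.1.sourceᶜ = ∅ := by
    ext w
    simpa using fun hw => e.1.map_target hw
  rw [this, setLIntegral_empty]

/-- The chart measures agree on overlaps, so the part of any `chartArea e'` inside the source of `e`
is at most `chartArea e`. Hence the supremum adds nothing to `chartArea e` there, and integrals over
a coordinate patch become integrals over `ℂ`. -/
theorem HermitianMetric.area_restrict_source (e : HolChart S) :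
    g.area.restrict e.1.source = g.chartArea e := by
  have hs := e.1.open_source.measurableSet
  have h1 : g.chartArea e ≤ g.area := le_iSup (fun e => g.chartArea e) e
  have h2 : (g.chartArea e).restrict e.1.source = g.chartArea e :=
    Measure.restrict_eq_self_of_ae_mem (by
      rw [ae_iff]; exact g.chartArea_compl_source e)
  refine le_antisymm ?_ (h2 ▸ Measure.restrict_mono le_rfl h1)
  have h3 : g.area ≤ g.chartArea e + g.area.restrict e.1.sourceᶜ := by
    refine iSup_le fun e' => Measure.le_iff.mpr fun A hA => ?_
    rw [← measure_inter_add_sdiff A hs, Measure.add_apply,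
      Measure.restrict_apply hA]
    refine add_le_add ?_ (le_iSup (fun e => g.chartArea e) e' _)
    rw [← measure_inter_add_sdiff (A ∩ e.1.source) e'.1.open_source.measurableSet,
      measure_mono_null (s := (A ∩ e.1.source) \ e'.1.source) (t := e'.1.sourceᶜ) (fun x hx => hx.2) (g.chartArea_compl_source e'),
      add_zero, g.chartArea_apply_eq e' e ((hA.inter hs).inter e'.1.open_source.measurableSet)
        inter_subset_right (inter_subset_left.trans inter_subset_right)]
    exact measure_mono (inter_subset_left.trans inter_subset_left)
  calc g.area.restrict e.1.source ≤ (g.chartArea e + g.area.restrict e.1.sourceᶜ).restrict e.1.source :=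
        Measure.restrict_mono le_rfl h3
    _ = g.chartArea e := by
        rw [Measure.restrict_add, h2, Measure.restrict_restrict hs]
        simp

theorem HermitianMetric.area_apply (e : HolChart S) {A : Set S} (hA : MeasurableSet A)
    (h : A ⊆ e.1.source) :
    g.area A = ∫⁻ w in e.1.target ∩ e.1.symm ⁻¹' A, ENNReal.ofReal (g.density e w) := by
  rw [← g.chartArea_apply e hA, ← g.area_restrict_source e, Measure.restrict_apply hA,
    inter_eq_left.mpr h]

theorem HolChart.isOpen_image_symm (e : HolChart S) {W : Set ℂ} (hW : IsOpen W)
    (hWt : W ⊆ e.1.target) : IsOpen (e.1.symm '' W) :=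
  e.1.symm.isOpen_image_of_subset_source hW hWt

theorem HolChart.target_inter_preimage_image (e : HolChart S) {W : Set ℂ} (hWt : W ⊆ e.1.target) :
    e.1.target ∩ e.1.symm ⁻¹' (e.1.symm '' W) = W := by
  ext w
  constructor
  · rintro ⟨h1, v, hv, hvw⟩
    rwa [← e.1.symm.injOn (hWt hv) h1 hvw]
  · exact fun hw => ⟨hWt hw, w, hw, rfl⟩

theorem HermitianMetric.setIntegral_area (e : HolChart S) {W : Set ℂ} (hW : IsOpen W)
    (hWt : W ⊆ e.1.target) {φ : S → ℂ}
    (hφ : AEStronglyMeasurable φ (g.area.restrict (e.1.symm '' W))) :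
    ∫ x in e.1.symm '' W, φ x ∂g.area = ∫ w in W, (g.density e w : ℂ) * φ (e.1.symm w) := by
  have hA := (e.isOpen_image_symm hW hWt).measurableSet
  have hAs : e.1.symm '' W ⊆ e.1.source := by
    rintro _ ⟨w, hw, rfl⟩
    exact e.1.map_target (hWt hw)
  have h2 : AEMeasurable e.1.symm ((g.coordArea e).restrict W) :=
    ((e.aemeasurable_symm.mono_ac (g.coordArea_ac e))).restrict
  have h0 : (g.coordArea e).restrict (e.1.symm ⁻¹' (e.1.symm '' W)) = (g.coordArea e).restrict W := by
    rw [HermitianMetric.coordArea, restrict_withDensity', restrict_withDensity',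
      Measure.restrict_restrict₀ (e.aemeasurable_symm.nullMeasurable hA), inter_comm,
      e.target_inter_preimage_image hWt, Measure.restrict_restrict hW.measurableSet,
      inter_eq_left.mpr hWt]
  have h1 : g.area.restrict (e.1.symm '' W) = Measure.map e.1.symm ((g.coordArea e).restrict W) := by
    conv_lhs =>
      rw [← inter_eq_left.mpr hAs, ← Measure.restrict_restrict hA, g.area_restrict_source]
    rw [← h0, ← Measure.restrict_map_of_aemeasurable (e.aemeasurable_symm.mono_ac (g.coordArea_ac e)) hA]
    rfl
  have h3 : (g.coordArea e).restrict W =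
      (volume.restrict W).withDensity fun w => ENNReal.ofReal (g.density e w) := by
    rw [HermitianMetric.coordArea, restrict_withDensity', Measure.restrict_restrict hW.measurableSet,
      inter_eq_left.mpr hWt]
  rw [h1] at hφ ⊢
  rw [integral_map h2 hφ, h3, integral_withDensity_eq_integral_toReal_smul₀ _ (by simp)]
  · refine setIntegral_congr_fun hW.measurableSet fun w hw => ?_
    simp only [ENNReal.toReal_ofReal (g.density_pos e w (hWt hw)).le, Complex.real_smul]
  · exact (((g.density_smooth e).continuousOn.mono hWt).aemeasurable hW.measurableSet).ennreal_ofReal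

/-- The density is bounded on a closed coordinate disc, so the measure is locally finite, hence
finite by compactness. -/
theorem HermitianMetric.isFiniteMeasure_area [CompactSpace S] : IsFiniteMeasure g.area := by
  have : IsLocallyFiniteMeasure g.area := by
    refine ⟨fun x => ?_⟩
    set e := HolChart.at x with he
    have hx : x ∈ e.1.source := mem_chart_source ℂ x
    obtain ⟨r, hr, hrt⟩ := Metric.nhds_basis_closedBall.mem_iff.mp
      (e.1.open_target.mem_nhds (e.1.map_source hx))
    have hball : Metric.ball (e.1 x) r ⊆ e.1.target := Metric.ball_subset_closedBall.trans hrt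
    refine ⟨e.1.symm '' Metric.ball (e.1 x) r, (e.isOpen_image_symm Metric.isOpen_ball hball).mem_nhds
      ⟨e.1 x, Metric.mem_ball_self hr, e.1.left_inv hx⟩, ?_⟩
    rw [g.area_apply e (e.isOpen_image_symm Metric.isOpen_ball hball).measurableSet,
      e.target_inter_preimage_image hball]
    · obtain ⟨B, hB⟩ := (isCompact_closedBall (e.1 x) r).bddAbove_image
        ((g.density_smooth e).continuousOn.mono hrt)
      refine (setLIntegral_mono measurable_const (g := fun _ => ENNReal.ofReal B) fun w hw =>
        ENNReal.ofReal_le_ofReal (hB ⟨w, Metric.ball_subset_closedBall hw, rfl⟩)).trans_lt ?_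
      rw [setLIntegral_const]
      exact ENNReal.mul_lt_top ENNReal.ofReal_lt_top measure_ball_lt_top
    · rintro _ ⟨w, hw, rfl⟩
      exact e.1.map_target (hball hw)
  exact ⟨isCompact_univ.measure_lt_top⟩

/-- Needed to solve the degree formula for `C`. -/
theorem HermitianMetric.vol_pos [CompactSpace S] [Nonempty S] : 0 < g.vol := by
  have := g.isFiniteMeasure_area
  obtain ⟨x⟩ := ‹Nonempty S›
  set e := HolChart.at x with he
  have hx : x ∈ e.1.source := mem_chart_source ℂ x
  refine ENNReal.toReal_pos (fun h0 => ?_) (measure_ne_top _ _)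
  have h1 : g.area e.1.source = 0 := measure_mono_null (subset_univ _) h0
  rw [g.area_apply e e.1.open_source.measurableSet subset_rfl,
    inter_eq_left.mpr (show e.1.target ⊆ e.1.symm ⁻¹' e.1.source from fun w hw => e.1.map_target hw),
    lintegral_eq_zero_iff'
    (((g.density_smooth e).continuousOn.aemeasurable
      e.1.open_target.measurableSet).ennreal_ofReal)] at h1
  have h2 : ∀ᵐ w ∂(volume.restrict e.1.target), False := by
    filter_upwards [h1, ae_restrict_mem e.1.open_target.measurableSet] with w hw hwt
    exact absurd hw (ENNReal.ofReal_pos.mpr (g.density_pos e w hwt)).ne'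
  have h3 : volume e.1.target = 0 := by simpa using h2
  exact (e.1.open_target.measure_pos volume ⟨_, e.1.map_source hx⟩).ne' h3

end Area

/-! ### Stokes' theorem on a compact Riemann surface. -/

section Stokes

/-- Integration by parts against the constant function `1`. -/
theorem integral_fderiv_eq_zero_of_hasCompactSupport {F : ℂ → ℂ} (hF : ContDiff ℝ 1 F)
    (hc : HasCompactSupport F) (v : ℂ) : ∫ w, fderiv ℝ F w v = 0 := by
  have hd : Continuous fun w => fderiv ℝ F w v :=
    (hF.continuous_fderiv (by simp)).clm_apply continuous_const
  have hcd : HasCompactSupport fun w => fderiv ℝ F w v := hc.fderiv_apply (𝕜 := ℝ) v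
  have h := integral_bilinear_hasLineDerivAt_right_eq_neg_left_of_integrable (μ := volume)
    (f := fun _ : ℂ => (1 : ℂ)) (f' := fun _ => 0) (g := F) (g' := fun w => fderiv ℝ F w v) (v := v)
    (B := ContinuousLinearMap.mul ℝ ℂ) (by simp)
    (by simpa using hd.integrable_of_hasCompactSupport hcd)
    (by simpa using hF.continuous.integrable_of_hasCompactSupport hc)
    (fun x _ => by simpa using (hasFDerivAt_const (𝕜 := ℝ) (1 : ℂ) x).hasLineDerivAt v)
    (fun x _ => ((hF.differentiable (by simp)) x).hasFDerivAt.hasLineDerivAt v)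
  simpa using h

theorem integral_curl_eq_zero {β : ℂ → ℂ →L[ℝ] ℂ} (hβ : ContDiff ℝ 1 β)
    (hc : HasCompactSupport β) : ∫ w, curl β w = 0 := by
  have h : ∀ v u : ℂ, Continuous (fun w => fderiv ℝ β w v u) ∧
      HasCompactSupport (fun w => fderiv ℝ β w v u) ∧ ∫ w, fderiv ℝ β w v u = 0 := by
    intro v u
    have h1 : ContDiff ℝ 1 fun w => β w u := hβ.clm_apply contDiff_const
    have h2 : HasCompactSupport fun w => β w u := hc.comp_left (g := fun L : ℂ →L[ℝ] ℂ => L u) rfl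
    have h3 : (fun w => fderiv ℝ β w v u) = fun w => fderiv ℝ (fun w => β w u) w v := by
      ext w
      rw [fderiv_clm_apply ((hβ.differentiable (by simp)) w) (by fun_prop)]
      simp
    rw [h3]
    exact ⟨(h1.continuous_fderiv (by simp)).clm_apply continuous_const,
      h2.fderiv_apply (𝕜 := ℝ) v, integral_fderiv_eq_zero_of_hasCompactSupport h1 h2 v⟩
  obtain ⟨a1, a2, a3⟩ := h 1 Complex.I
  obtain ⟨b1, b2, b3⟩ := h Complex.I 1
  unfold curl
  rw [integral_sub (a1.integrable_of_hasCompactSupport a2) (b1.integrable_of_hasCompactSupport b2),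
    a3, b3, sub_zero]

theorem curl_congr {β γ : ℂ → ℂ →L[ℝ] ℂ} {w : ℂ} (h : β =ᶠ[𝓝 w] γ) : curl β w = curl γ w := by
  rw [curl, curl, h.fderiv_eq]

/-- The form vanishes on `U` outside the compact set `K`, so its extension by zero is smooth with
compact support on all of `ℂ`. -/
theorem integral_curl_eq_zero_of_isOpen {β : ℂ → ℂ →L[ℝ] ℂ} {U K : Set ℂ} (hU : IsOpen U)
    (hK : IsCompact K) (hKU : K ⊆ U) (hβ : ContDiffOn ℝ 1 β U) (h0 : ∀ w ∈ U, w ∉ K → β w = 0) :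
    ∫ w in U, curl β w = 0 := by
  have hin : ∀ w ∈ U, U.indicator β =ᶠ[𝓝 w] β := fun w hw => by
    filter_upwards [hU.mem_nhds hw] with v hv using indicator_of_mem hv β
  have hout : ∀ w ∉ K, U.indicator β =ᶠ[𝓝 w] 0 := fun w hw => by
    filter_upwards [hK.isClosed.isOpen_compl.mem_nhds hw] with v hv
    by_cases hvU : v ∈ U
    · rw [indicator_of_mem hvU]; exact h0 v hvU hv
    · exact indicator_of_notMem hvU β
  have hsmooth : ContDiff ℝ 1 (U.indicator β) := contDiff_iff_contDiffAt.mpr fun w => by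
    by_cases hw : w ∈ U
    · exact (hβ.contDiffAt (hU.mem_nhds hw)).congr_of_eventuallyEq (hin w hw)
    · exact (contDiffAt_const (c := 0)).congr_of_eventuallyEq (hout w fun h => hw (hKU h))
  have hc : HasCompactSupport (U.indicator β) :=
    HasCompactSupport.intro hK fun w hw => (hout w hw).self_of_nhds
  rw [← integral_curl_eq_zero hsmooth hc, ← integral_indicator hU.measurableSet]
  congr 1
  ext w
  by_cases hw : w ∈ U
  · rw [indicator_of_mem hw, curl_congr (hin w hw)]
  · rw [indicator_of_notMem hw, curl_congr (hout w fun h => hw (hKU h))]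
    simp [curl]

variable {S : Type*} [TopologicalSpace S] [ChartedSpace ℂ S] [IsManifold 𝓘(ℂ) ω S]

theorem HermitianMetric.density_ne_zero (g : HermitianMetric S) {e : HolChart S} {w : ℂ}
    (hw : w ∈ e.1.target) : (g.density e w : ℂ) ≠ 0 :=
  Complex.ofReal_ne_zero.mpr (g.density_pos e w hw).ne'

/-- The function `f` such that `dβ = f • (area form)`. -/
def SmoothOneForm.curlDensity (g : HermitianMetric S) (β : SmoothOneForm S) (x : S) : ℂ :=
  curl (β.coord (HolChart.at x)) ((HolChart.at x).1 x) / g.density (HolChart.at x) ((HolChart.at x).1 x)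

/-- The definition of `curlDensity` uses the preferred chart at each point; the matching
transformation rules of curl and density show that any chart gives the same value. -/
theorem SmoothOneForm.density_mul_curlDensity (g : HermitianMetric S) (β : SmoothOneForm S)
    (e : HolChart S) {w : ℂ} (hw : w ∈ e.1.target) :
    (g.density e w : ℂ) * β.curlDensity g (e.1.symm w) = curl (β.coord e) w := by
  set x := e.1.symm w with hx
  have hxs : x ∈ (HolChart.at x).1.source := mem_chart_source ℂ x
  have ho : w ∈ e.overlap (HolChart.at x) := HolChart.mem_overlap.mpr ⟨hw, hxs⟩
  have h1 : (HolChart.at x).1 x = e.trans (HolChart.at x) w := rfl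
  have h2 := g.density_ne_zero (HolChart.trans_mem_target ho)
  rw [β.curl_trans ho, SmoothOneForm.curlDensity, h1, g.density_transform e (HolChart.at x) w ho]
  change ((g.density _ (e.trans (HolChart.at x) w) * ‖deriv (e.trans (HolChart.at x)) w‖ ^ 2 : ℝ) : ℂ)
    * _ = _
  push_cast
  field_simp

theorem SmoothOneForm.curlDensity_eq (g : HermitianMetric S) (β : SmoothOneForm S)
    (e : HolChart S) {x : S} (hx : x ∈ e.1.source) :
    β.curlDensity g x = curl (β.coord e) (e.1 x) / g.density e (e.1 x) := by
  have h := β.density_mul_curlDensity g e (e.1.map_source hx)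
  rw [e.1.left_inv hx] at h
  rw [← h, mul_div_cancel_left₀ _ (g.density_ne_zero (e.1.map_source hx))]

theorem SmoothOneForm.continuous_curlDensity (g : HermitianMetric S) (β : SmoothOneForm S) :
    Continuous (β.curlDensity g) := by
  refine continuous_iff_continuousAt.mpr fun x => ?_
  set e := HolChart.at x with he
  have hx : x ∈ e.1.source := mem_chart_source ℂ x
  have h1 : β.curlDensity g =ᶠ[𝓝 x] fun y => curl (β.coord e) (e.1 y) / g.density e (e.1 y) := by
    filter_upwards [e.1.open_source.mem_nhds hx] with y hy using β.curlDensity_eq g e hy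
  have ht := e.1.map_source hx
  have h2 : ContinuousAt (fderiv ℝ (β.coord e)) (e.1 x) :=
    ((β.contDiffAt ht).fderiv_right (m := 0) (by simp)).continuousAt
  have h3 : ContinuousAt (curl (β.coord e)) (e.1 x) := by
    unfold curl
    exact ((h2.clm_apply continuousAt_const).clm_apply continuousAt_const).sub
      ((h2.clm_apply continuousAt_const).clm_apply continuousAt_const)
  have h4 : ContinuousAt (fun w => (g.density e w : ℂ)) (e.1 x) :=
    Complex.continuous_ofReal.continuousAt.comp
      ((g.density_smooth e).continuousOn.continuousAt (e.1.open_target.mem_nhds ht))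
  have h5 := h3.div h4 (g.density_ne_zero ht)
  exact (h5.comp (e.1.continuousAt hx)).congr h1.symm

/-- The product of a smooth function and a one-form. -/
def SmoothOneForm.smul (χ : S → ℝ) (hχ : ContMDiff 𝓘(ℝ, ℂ) 𝓘(ℝ) ∞ χ) (β : SmoothOneForm S) :
    SmoothOneForm S where
  coord e w := χ (e.1.symm w) • β.coord e w
  smooth e := (e.contDiffOn_of_contMDiff hχ).smul (β.smooth e)
  compatible e e' w hw := by
    rw [β.compatible e e' w hw, HolChart.symm_trans hw]
    rfl

theorem SmoothOneForm.smul_coord (χ : S → ℝ) (hχ : ContMDiff 𝓘(ℝ, ℂ) 𝓘(ℝ) ∞ χ)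
    (β : SmoothOneForm S) (e : HolChart S) (w : ℂ) :
    (β.smul χ hχ).coord e w = χ (e.1.symm w) • β.coord e w := rfl

variable [T2Space S] [CompactSpace S] [MeasurableSpace S] [BorelSpace S]

/-- The local case of Stokes' theorem: a form supported in one chart, where the integral becomes
that of a curl with compact support in `ℂ`. -/
theorem SmoothOneForm.integral_curlDensity_smul (g : HermitianMetric S) {χ : S → ℝ}
    (hχ : ContMDiff 𝓘(ℝ, ℂ) 𝓘(ℝ) ∞ χ) (β : SmoothOneForm S) (e : HolChart S)
    (hsupp : tsupport χ ⊆ e.1.source) : ∫ x, (β.smul χ hχ).curlDensity g x ∂g.area = 0 := by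
  set γ := β.smul χ hχ with hγ
  have hcont := γ.continuous_curlDensity g
  have himage : e.1.symm '' e.1.target = e.1.source := e.1.symm.image_source_eq_target
  -- Outside the chart the form vanishes on a whole neighbourhood, so its curl vanishes too.
  have h1 : ∀ x ∉ e.1.source, γ.curlDensity g x = 0 := by
    intro x hx
    have hx1 : x ∉ tsupport χ := fun h => hx (hsupp h)
    set e' := HolChart.at x with he'
    have hxs : x ∈ e'.1.source := mem_chart_source ℂ x
    have h2 : γ.coord e' =ᶠ[𝓝 (e'.1 x)] 0 := by
      have h3 : ContinuousAt e'.1.symm (e'.1 x) := e'.1.continuousAt_symm (e'.1.map_source hxs)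
      have h4 : (tsupport χ)ᶜ ∈ 𝓝 (e'.1.symm (e'.1 x)) := by
        rw [e'.1.left_inv hxs]
        exact (isClosed_tsupport χ).isOpen_compl.mem_nhds hx1
      filter_upwards [h3 h4] with w hw
      rw [hγ, SmoothOneForm.smul_coord, image_eq_zero_of_notMem_tsupport hw]
      exact ContinuousLinearMap.ext fun v => zero_smul ℝ (β.coord _ _ v)
    rw [γ.curlDensity_eq g e' hxs, curl_congr h2]
    simp [curl]
  rw [← setIntegral_eq_integral_of_forall_compl_eq_zero h1, ← himage,
    g.setIntegral_area e e.1.open_target subset_rfl hcont.aestronglyMeasurable,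
    setIntegral_congr_fun e.1.open_target.measurableSet
      (fun w hw => γ.density_mul_curlDensity g e hw)]
  have hcomp : IsCompact (e.1 '' tsupport χ) :=
    (isClosed_tsupport χ).isCompact.image_of_continuousOn (e.1.continuousOn.mono hsupp)
  refine integral_curl_eq_zero_of_isOpen e.1.open_target hcomp ?_
    ((γ.smooth e).of_le ENat.LEInfty.out) ?_
  · rintro _ ⟨x, hx, rfl⟩
    exact e.1.map_source (hsupp hx)
  · intro w hw hwK
    rw [hγ, SmoothOneForm.smul_coord, image_eq_zero_of_notMem_tsupport (fun h => hwK ⟨_, h, e.1.right_inv hw⟩)]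
    exact ContinuousLinearMap.ext fun v => zero_smul ℝ (β.coord _ _ v)

/-- Stokes' theorem on a compact Riemann surface. -/
theorem SmoothOneForm.integral_curlDensity (g : HermitianMetric S) (β : SmoothOneForm S) :
    ∫ x, β.curlDensity g x ∂g.area = 0 := by
  have := g.isFiniteMeasure_area
  obtain ⟨f, hf⟩ := SmoothPartitionOfUnity.exists_isSubordinate_chartAt_source 𝓘(ℝ, ℂ) S
  have hfin := f.locallyFinite.finite_nonempty_of_compact
  set s := hfin.toFinset with hs
  have hsum : ∀ x, ∑ i ∈ s, f i x = 1 := by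
    intro x
    rw [← f.sum_eq_one (mem_univ x), finsum_eq_sum_of_support_subset]
    intro i hi
    simp only [hs, Finite.coe_toFinset, mem_ofPred_eq]
    exact ⟨x, hi⟩
  -- The curl is linear and `∑ f_i = 1`, so `dβ = ∑ d(f_i β)`; compactness makes the partition of
  -- unity finite.
  have hdens : ∀ x, β.curlDensity g x =
      ∑ i ∈ s, (β.smul (f i) (f i).contMDiff).curlDensity g x := by
    intro x
    set e := HolChart.at x with he
    have hxs : x ∈ e.1.source := mem_chart_source ℂ x
    have ht := e.1.map_source hxs
    rw [β.curlDensity_eq g e hxs, Finset.sum_congr rfl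
      fun i _ => (β.smul (f i) (f i).contMDiff).curlDensity_eq g e hxs, ← Finset.sum_div]
    congr 1
    have h1 : β.coord e = fun w => ∑ i ∈ s, (β.smul (f i) (f i).contMDiff).coord e w := by
      ext1 w
      change β.coord e w = ∑ i ∈ s, f i (e.1.symm w) • β.coord e w
      rw [← Finset.sum_smul, hsum, one_smul]
    have h2 : fderiv ℝ (β.coord e) (e.1 x) =
        ∑ i ∈ s, fderiv ℝ ((β.smul (f i) (f i).contMDiff).coord e) (e.1 x) := by
      conv_lhs => rw [h1]
      exact fderiv_fun_sum fun i _ => (β.smul (f i) (f i).contMDiff).differentiableAt ht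
    unfold curl
    rw [h2, Finset.sum_sub_distrib]
    simp [sum_apply]
  simp_rw [hdens]
  rw [integral_finsetSum]
  · exact Finset.sum_eq_zero fun i _ =>
      β.integral_curlDensity_smul g (f i).contMDiff (HolChart.at i) (hf i)
  · exact fun i _ => ((β.smul (f i) (f i).contMDiff).continuous_curlDensity g).integrable_of_hasCompactSupport
      (HasCompactSupport.of_compactSpace _)

end Stokes

/-! ### Piecewise constant functions on an interval and their jumps. -/

section Jumps

theorem exists_eventually_eq_const_of_hasDerivAt_zero {p : ℝ → ℂ} {x : ℝ}
    (h : ∀ᶠ s in 𝓝[≠] x, HasDerivAt p 0 s) :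
    (∃ c, ∀ᶠ s in 𝓝[>] x, p s = c) ∧ ∃ c, ∀ᶠ s in 𝓝[<] x, p s = c := by
  have key : ∀ a b : ℝ, (∀ s ∈ Ioo a b, HasDerivAt p 0 s) →
      ∀ y ∈ Ioo a b, ∀ s ∈ Ioo a b, p s = p y := fun a b hab y hy s hs =>
    isOpen_Ioo.is_const_of_deriv_eq_zero isPreconnected_Ioo
      (fun v hv => (hab v hv).differentiableAt.differentiableWithinAt)
      (fun v hv => (hab v hv).deriv) hs hy
  obtain ⟨h1, h2⟩ : (∀ᶠ s in 𝓝[<] x, HasDerivAt p 0 s) ∧ ∀ᶠ s in 𝓝[>] x, HasDerivAt p 0 s := by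
    rwa [← eventually_sup, ← nhdsLT_sup_nhdsGT] at *
  constructor
  · obtain ⟨b, hb, hb'⟩ := mem_nhdsGT_iff_exists_Ioo_subset.mp h2
    exact ⟨p ((x + b) / 2), by
      filter_upwards [Ioo_mem_nhdsGT hb] with s hs
      exact key x b hb' _ ⟨by linarith [mem_Ioi.mp hb], by linarith [mem_Ioi.mp hb]⟩ s hs⟩
  · obtain ⟨b, hb, hb'⟩ := mem_nhdsLT_iff_exists_Ioo_subset.mp h1
    exact ⟨p ((x + b) / 2), by
      filter_upwards [Ioo_mem_nhdsLT hb] with s hs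
      exact key b x hb' _ ⟨by linarith [mem_Iio.mp hb], by linarith [mem_Iio.mp hb]⟩ s hs⟩

/-- A piecewise constant function on `[0, T]` changes by the sum of its jumps. -/
theorem sub_eq_sum_jumps {T : ℝ} (hT : 0 < T) {N : ℕ} {t : Fin N → ℝ} (ht : ∀ j, t j ∈ Ioo 0 T)
    (J : Fin N → ℂ) {p : ℝ → ℂ}
    (hd : ∀ x ∈ Icc 0 T, ∀ᶠ s in 𝓝[≠] x, HasDerivAt p 0 s)
    (hc : ∀ x ∈ Icc 0 T, (∀ j, t j ≠ x) → ContinuousAt p x)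
    (hj : ∀ i, Tendsto (fun ε => p (t i + ε) - p (t i - ε)) (𝓝[>] 0)
      (𝓝 (∑ j with t j = t i, J j))) :
    p T - p 0 = ∑ j, J j := by
  -- Subtracting the jumps already passed leaves a function that is constant across every jump time,
  -- except possibly for its value there, about which nothing is assumed. The punctured limits `l`
  -- discard these values and are locally constant everywhere on `[0, T]`.
  set q : ℝ → ℂ := fun s => p s - ∑ j with t j < s, J j with hq
  set l : ℝ → ℂ := fun x => limUnder (𝓝[≠] x) q with hl
  have hplus : ∀ x : ℝ, Tendsto (fun ε => x + ε) (𝓝[>] 0) (𝓝[>] x) := fun x =>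
    tendsto_nhdsWithin_iff.mpr ⟨(Continuous.tendsto' (by fun_prop) _ _ (by simp)).mono_left
      nhdsWithin_le_nhds, by filter_upwards [self_mem_nhdsWithin] with ε hε; simpa using hε⟩
  have hminus : ∀ x : ℝ, Tendsto (fun ε => x - ε) (𝓝[>] 0) (𝓝[<] x) := fun x =>
    tendsto_nhdsWithin_iff.mpr ⟨(Continuous.tendsto' (by fun_prop) _ _ (by simp)).mono_left
      nhdsWithin_le_nhds, by filter_upwards [self_mem_nhdsWithin] with ε hε; simpa using hε⟩
  -- With `a` and `b` the right and left values of `p` near `x`, the difference `a - b` is the jump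
  -- at `x`; it is compensated by the terms `t j = x` that enter the sum to the right of `x`.
  have hlocal : ∀ x ∈ Icc 0 T, ∃ c, (∀ᶠ s in 𝓝[≠] x, q s = c) ∧
      ((∀ j, t j ≠ x) → c = p x - ∑ j with t j ≤ x, J j) := by
    intro x hx
    obtain ⟨⟨a, ha⟩, b, hb⟩ := exists_eventually_eq_const_of_hasDerivAt_zero (hd x hx)
    have hjump : Tendsto (fun ε => p (x + ε) - p (x - ε)) (𝓝[>] 0)
        (𝓝 (∑ j with t j = x, J j)) := by
      by_cases hxt : ∃ i, t i = x
      · obtain ⟨i, rfl⟩ := hxt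
        exact hj i
      · push Not at hxt
        rw [Finset.filter_false_of_mem fun j _ => hxt j, Finset.sum_empty, ← sub_self (p x)]
        exact ((hc x hx hxt).tendsto.comp ((hplus x).mono_right nhdsWithin_le_nhds)).sub
          ((hc x hx hxt).tendsto.comp ((hminus x).mono_right nhdsWithin_le_nhds))
    have hab : a - b = ∑ j with t j = x, J j := by
      refine tendsto_nhds_unique (Tendsto.congr' ?_ tendsto_const_nhds) hjump
      filter_upwards [(hplus x).eventually ha, (hminus x).eventually hb] with ε h1 h2
      rw [h1, h2]
    have hsum : ∑ j with t j ≤ x, J j = ∑ j with t j < x, J j + ∑ j with t j = x, J j := by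
      rw [← Finset.sum_union]
      · congr 1
        ext j
        simp [le_iff_lt_or_eq]
      · exact Finset.disjoint_filter.mpr fun j _ h1 h2 => h1.ne h2
    have hright : ∀ᶠ s in 𝓝[>] x, q s = a - ∑ j with t j ≤ x, J j := by
      have h1 : ∀ᶠ s in 𝓝[>] x, ∀ j, t j < s ↔ t j ≤ x := eventually_all.mpr fun j => by
        rcases le_or_gt (t j) x with h | h
        · filter_upwards [self_mem_nhdsWithin] with s hs
          exact ⟨fun _ => h, fun _ => h.trans_lt hs⟩
        · filter_upwards [nhdsWithin_le_nhds (Iio_mem_nhds h)] with s hs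
          exact ⟨fun h2 => absurd h2 (not_lt.mpr (le_of_lt hs)), fun h2 => absurd h (not_lt.mpr h2)⟩
      filter_upwards [ha, h1] with s hs h1
      simp only [hq, hs, h1]
    have hleft : ∀ᶠ s in 𝓝[<] x, q s = a - ∑ j with t j ≤ x, J j := by
      have h1 : ∀ᶠ s in 𝓝[<] x, ∀ j, t j < s ↔ t j < x := eventually_all.mpr fun j => by
        rcases lt_or_ge (t j) x with h | h
        · filter_upwards [nhdsWithin_le_nhds (Ioi_mem_nhds h)] with s hs
          exact ⟨fun _ => h, fun _ => hs⟩
        · filter_upwards [self_mem_nhdsWithin] with s hs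
          exact ⟨fun h2 => h2.trans hs, fun h2 => absurd h2 (not_lt.mpr h)⟩
      filter_upwards [hb, h1] with s hs h1
      simp only [hq, hs, h1]
      rw [hsum, ← hab]
      ring
    refine ⟨a - ∑ j with t j ≤ x, J j, ?_, fun hxt => ?_⟩
    · rw [← nhdsLT_sup_nhdsGT]
      exact eventually_sup.mpr ⟨hleft, hright⟩
    · congr 1
      refine tendsto_nhds_unique (l := 𝓝[>] x) (Tendsto.congr' ?_ tendsto_const_nhds)
        ((hc x hx hxt).tendsto.mono_left nhdsWithin_le_nhds)
      filter_upwards [ha] with s hs using hs.symm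
  have hlim : ∀ x c, (∀ᶠ s in 𝓝[≠] x, q s = c) → l x = c := fun x c h =>
    Tendsto.limUnder_eq (tendsto_const_nhds.congr' (h.mono fun _ hs => hs.symm))
  have hlconst : ∀ x ∈ Icc 0 T, HasDerivAt l 0 x := by
    intro x hx
    obtain ⟨c, h1, -⟩ := hlocal x hx
    have h2 : l =ᶠ[𝓝 x] fun _ => c := by
      have h3 : ∀ᶠ y in 𝓝[≠] x, l y = c := by
        filter_upwards [eventually_eventually_nhdsWithin.mpr h1, self_mem_nhdsWithin] with y hy hyx
        refine hlim y c ?_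
        rw [nhdsWithin_eq_nhds.mpr (isOpen_compl_singleton.mem_nhds hyx)] at hy
        exact hy.filter_mono nhdsWithin_le_nhds
      filter_upwards [eventually_nhdsWithin_iff.mp h3] with y hy
      by_cases hyx : y = x
      · exact hyx ▸ hlim x c h1
      · exact hy hyx
    exact (hasDerivAt_const x c).congr_of_eventuallyEq h2
  have hconst : l T = l 0 := constant_of_has_deriv_right_zero
    (fun x hx => (hlconst x hx).continuousAt.continuousWithinAt)
    (fun x hx => (hlconst x ⟨hx.1, hx.2.le⟩).hasDerivWithinAt) T ⟨hT.le, le_rfl⟩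
  obtain ⟨a, ha, ha'⟩ := hlocal 0 ⟨le_rfl, hT.le⟩
  obtain ⟨b, hb, hb'⟩ := hlocal T ⟨hT.le, le_rfl⟩
  -- No jump lies at `0` or `T`, so `l` there is computed from the actual values `p 0` and `p T`.
  have ha2 := ha' fun j => (ht j).1.ne'
  have hb2 := hb' fun j => (ht j).2.ne
  rw [Finset.filter_false_of_mem fun j _ => not_le.mpr (ht j).1, Finset.sum_empty] at ha2
  rw [Finset.filter_true_of_mem fun j _ => (ht j).2.le] at hb2
  rw [hlim _ _ ha, hlim _ _ hb, ha2, hb2] at hconst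
  linear_combination hconst

end Jumps

/-! ### The kernel `ε / R³` as an approximate delta function on a disc. -/

section Kernel

/-- `ε / R³` with `R² = ε² + |w|²`; its integral over `ℂ` is `2π`. -/
def dipoleKernel (ε : ℝ) (w : ℂ) : ℝ := ε / Real.sqrt (ε ^ 2 + ‖w‖ ^ 2) ^ 3

theorem hasDerivAt_neg_div_sqrt {ε : ℝ} (hε : 0 < ε) (s : ℝ) :
    HasDerivAt (fun s => -(ε / Real.sqrt (ε ^ 2 + s ^ 2)))
      (s * (ε / Real.sqrt (ε ^ 2 + s ^ 2) ^ 3)) s := by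
  have hpos : 0 < ε ^ 2 + s ^ 2 := by positivity
  have h1 : HasDerivAt (fun s => ε ^ 2 + s ^ 2) (2 * s) s := by
    simpa using ((hasDerivAt_pow 2 s).const_add (ε ^ 2))
  have h2 := ((h1.sqrt hpos.ne').inv (Real.sqrt_ne_zero'.mpr hpos)).const_mul (-ε)
  have h3 : (fun s => -(ε / Real.sqrt (ε ^ 2 + s ^ 2))) =
      fun s => -ε * (Real.sqrt (ε ^ 2 + s ^ 2))⁻¹ := by
    ext s
    rw [div_eq_mul_inv, neg_mul]
  rw [h3]
  refine h2.congr_deriv ?_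
  have := Real.sqrt_pos.mpr hpos
  field_simp

/-- Polar coordinates and the primitive `-ε / R`. The value is the solid angle `2π (1 - cos α)`
under which the disc is seen from height `ε`. -/
theorem setIntegral_dipoleKernel {ε r : ℝ} (hε : 0 < ε) (hr : 0 < r) :
    ∫ w in Metric.ball (0 : ℂ) r, dipoleKernel ε w =
      2 * Real.pi * (1 - ε / Real.sqrt (ε ^ 2 + r ^ 2)) := by
  have hcont : Continuous fun s => s * (ε / Real.sqrt (ε ^ 2 + s ^ 2) ^ 3) :=
    continuous_id.mul (continuous_const.div (by fun_prop) fun s => by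
      have : 0 < ε ^ 2 + s ^ 2 := by positivity
      exact (pow_pos (Real.sqrt_pos.mpr this) 3).ne')
  have h1 : ∫ w in Metric.ball (0 : ℂ) r, dipoleKernel ε w =
      ∫ w : ℂ, (Iio r).indicator (fun s => ε / Real.sqrt (ε ^ 2 + s ^ 2) ^ 3) ‖w‖ := by
    rw [← integral_indicator Metric.isOpen_ball.measurableSet]
    congr 1
    ext w
    simp [indicator, dipoleKernel]
  rw [h1, integral_fun_norm_addHaar volume]
  have h2 : ∫ y in Ioi (0 : ℝ), y ^ (Module.finrank ℝ ℂ - 1) •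
      (Iio r).indicator (fun s => ε / Real.sqrt (ε ^ 2 + s ^ 2) ^ 3) y =
      ∫ y in (0 : ℝ)..r, y * (ε / Real.sqrt (ε ^ 2 + y ^ 2) ^ 3) := by
    rw [intervalIntegral.integral_of_le hr.le, ← integral_Ioc_eq_integral_Ioo.symm,
      ← integral_indicator measurableSet_Ioi, ← integral_indicator measurableSet_Ioo]
    congr 1
    ext y
    by_cases h0 : 0 < y <;> by_cases hyr : y < r <;> simp [indicator, h0, hyr, Complex.finrank_real_complex]
  rw [h2, intervalIntegral.integral_eq_sub_of_hasDerivAt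
    (fun s _ => hasDerivAt_neg_div_sqrt hε s) (hcont.intervalIntegrable _ _)]
  have h3 : volume.real (Metric.ball (0 : ℂ) 1) = Real.pi := by
    simp [Measure.real, Complex.volume_ball]
  rw [h3, Complex.finrank_real_complex]
  simp [Real.sqrt_sq hε.le, div_self hε.ne']
  ring

theorem tendsto_setIntegral_dipoleKernel {r : ℝ} (hr : 0 < r) :
    Tendsto (fun ε => ∫ w in Metric.ball (0 : ℂ) r, dipoleKernel ε w) (𝓝[>] 0)
      (𝓝 (2 * Real.pi)) := by
  have h : Tendsto (fun ε : ℝ => 2 * Real.pi * (1 - ε / Real.sqrt (ε ^ 2 + r ^ 2))) (𝓝[>] 0)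
      (𝓝 (2 * Real.pi)) := by
    have hc : Continuous fun ε : ℝ => 2 * Real.pi * (1 - ε / Real.sqrt (ε ^ 2 + r ^ 2)) :=
      continuous_const.mul (continuous_const.sub (continuous_id.div (by fun_prop) fun s =>
        (Real.sqrt_pos.mpr (by positivity)).ne'))
    exact (hc.tendsto' 0 _ (by simp)).mono_left nhdsWithin_le_nhds
  refine h.congr' ?_
  filter_upwards [self_mem_nhdsWithin] with ε hε
  exact (setIntegral_dipoleKernel hε hr).symm

/-- In polar coordinates the factor `y` of the area element cancels `y⁻¹`. This supplies the
dominating function for the jump at a puncture. -/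
theorem integrableOn_inv_norm_ball (r : ℝ) :
    IntegrableOn (fun w : ℂ => ‖w‖⁻¹) (Metric.ball 0 r) := by
  rw [integrableOn_fun_norm_addHaar volume (f := fun y : ℝ => y⁻¹)]
  rw [integrableOn_congr_fun (g := fun _ => (1 : ℝ)) _ measurableSet_Ioo]
  · exact integrableOn_const (by simp)
  · intro y hy
    simp [Complex.finrank_real_complex, hy.1.ne']

theorem norm_le_sqrt_add (ε : ℝ) (w : ℂ) : ‖w‖ ≤ Real.sqrt (ε ^ 2 + ‖w‖ ^ 2) :=
  Real.le_sqrt_of_sq_le (by nlinarith [sq_nonneg ε])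

theorem continuous_dipoleKernel {ε : ℝ} (hε : 0 < ε) : Continuous (dipoleKernel ε) :=
  continuous_const.div (by fun_prop) fun s => by
    have : 0 < ε ^ 2 + ‖s‖ ^ 2 := by positivity
    exact (pow_pos (Real.sqrt_pos.mpr this) 3).ne'

/-- Both `ε` and `|w|` are at most `R`. Thus an error of order `|w|` in the density costs only an
integrable `|w|⁻¹`. -/
theorem norm_mul_dipoleKernel_le {ε : ℝ} (hε : 0 < ε) {w : ℂ} (hw : w ≠ 0) :
    ‖w‖ * dipoleKernel ε w ≤ ‖w‖⁻¹ := by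
  have h0 := norm_pos_iff.mpr hw
  have h1 := norm_le_sqrt_add ε w
  have h2 : ε ≤ Real.sqrt (ε ^ 2 + ‖w‖ ^ 2) :=
    Real.le_sqrt_of_sq_le (by nlinarith [sq_nonneg ‖w‖])
  unfold dipoleKernel
  set R := Real.sqrt (ε ^ 2 + ‖w‖ ^ 2)
  have hR : 0 < R := hε.trans_le h2
  rw [← mul_div_assoc, div_le_iff₀ (pow_pos hR 3), inv_mul_eq_div, le_div_iff₀ h0]
  have h3 : ‖w‖ * ε ≤ R * R := mul_le_mul h1 h2 hε.le hR.le
  calc ‖w‖ * ε * ‖w‖ ≤ R * R * R := mul_le_mul h3 h1 h0.le (by positivity)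
    _ = R ^ 3 := by ring

/-- Limit of the integrals of functions that approach a multiple of the dipole kernel. -/
theorem tendsto_setIntegral_of_near_dipole {r : ℝ} (hr : 0 < r) {ρ : ℂ → ℝ} {v : ℝ → ℂ → ℂ}
    {lam : ℂ} {L M B : ℝ}
    (hρm : ContinuousOn ρ (Metric.ball 0 r)) (hρB : ∀ w ∈ Metric.ball (0 : ℂ) r, |ρ w| ≤ B)
    (hρ : ∀ w ∈ Metric.ball (0 : ℂ) r, |ρ w - 1| ≤ L * ‖w‖)
    (hvm : ∀ᶠ ε in 𝓝[>] 0, ContinuousOn (v ε) (Metric.ball 0 r))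
    (hv : ∀ᶠ ε in 𝓝[>] 0, ∀ w ∈ Metric.ball (0 : ℂ) r, w ≠ 0 →
      ‖v ε w - lam * dipoleKernel ε w‖ ≤ M * ‖w‖⁻¹)
    (hlim : ∀ w ∈ Metric.ball (0 : ℂ) r, w ≠ 0 → Tendsto (fun ε => v ε w) (𝓝[>] 0) (𝓝 0)) :
    Tendsto (fun ε => ∫ w in Metric.ball (0 : ℂ) r, (ρ w : ℂ) * v ε w) (𝓝[>] 0)
      (𝓝 (lam * (2 * Real.pi))) := by
  have hms := (Metric.isOpen_ball (x := (0 : ℂ)) (ε := r)).measurableSet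
  have hne : ∀ᵐ w ∂(volume.restrict (Metric.ball (0 : ℂ) r)), w ∈ Metric.ball (0 : ℂ) r ∧ w ≠ 0 := by
    filter_upwards [ae_restrict_mem hms, ae_restrict_of_ae (Measure.ae_ne volume (0 : ℂ))] with w h1 h2
    exact ⟨h1, h2⟩
  have hkint : ∀ ε : ℝ, 0 < ε → IntegrableOn (fun w => lam * (dipoleKernel ε w : ℂ)) (Metric.ball 0 r) :=
    fun ε hε => (((Complex.continuous_ofReal.comp (continuous_dipoleKernel hε)).const_mul
      lam).locallyIntegrable.integrableOn_isCompact (isCompact_closedBall 0 r)).mono_set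
        Metric.ball_subset_closedBall
  have hmeas : ∀ᶠ ε in 𝓝[>] 0, AEStronglyMeasurable
      (fun w => (ρ w : ℂ) * v ε w - lam * dipoleKernel ε w)
        (volume.restrict (Metric.ball (0 : ℂ) r)) := by
    filter_upwards [hvm, self_mem_nhdsWithin] with ε h1 hε
    exact ((Complex.continuous_ofReal.comp_continuousOn hρm).mul h1).sub
      ((Complex.continuous_ofReal.comp (continuous_dipoleKernel hε)).const_mul
        lam).continuousOn |>.aestronglyMeasurable hms
  have hbd : ∀ᶠ ε in 𝓝[>] 0, ∀ᵐ w ∂(volume.restrict (Metric.ball (0 : ℂ) r)),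
      ‖(ρ w : ℂ) * v ε w - lam * dipoleKernel ε w‖ ≤ (B * M + ‖lam‖ * L) * ‖w‖⁻¹ := by
    filter_upwards [hv, self_mem_nhdsWithin] with ε h1 hε
    filter_upwards [hne] with w hw
    -- The first term is `O(|w|⁻¹)` by the hypothesis on `v`, the second because `|ρ - 1| ≤ L |w|`.
    have e1 : (ρ w : ℂ) * v ε w - lam * dipoleKernel ε w =
        ρ w * (v ε w - lam * dipoleKernel ε w) + lam * ((ρ w - 1 : ℝ) * dipoleKernel ε w : ℝ) := by
      push_cast; ring
    have hk : 0 ≤ dipoleKernel ε w := div_nonneg (le_of_lt hε) (by positivity)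
    have hL : 0 ≤ L := by
      have := (abs_nonneg _).trans (hρ w hw.1)
      exact nonneg_of_mul_nonneg_left this (norm_pos_iff.mpr hw.2)
    have e2 : |(ρ w - 1) * dipoleKernel ε w| ≤ L * ‖w‖⁻¹ := by
      rw [abs_mul, abs_of_nonneg hk]
      calc |ρ w - 1| * dipoleKernel ε w ≤ L * ‖w‖ * dipoleKernel ε w :=
            mul_le_mul_of_nonneg_right (hρ w hw.1) hk
        _ = L * (‖w‖ * dipoleKernel ε w) := by ring
        _ ≤ L * ‖w‖⁻¹ := mul_le_mul_of_nonneg_left (norm_mul_dipoleKernel_le hε hw.2) hL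
    rw [e1]
    refine (norm_add_le _ _).trans ?_
    rw [norm_mul, norm_mul, Complex.norm_real, Complex.norm_real, Real.norm_eq_abs, Real.norm_eq_abs]
    calc _ ≤ B * (M * ‖w‖⁻¹) + ‖lam‖ * (L * ‖w‖⁻¹) :=
          add_le_add (mul_le_mul (hρB w hw.1) (h1 w hw.1 hw.2) (norm_nonneg _)
            ((abs_nonneg _).trans (hρB w hw.1))) (mul_le_mul_of_nonneg_left e2 (norm_nonneg _))
      _ = _ := by ring
  have hbint : IntegrableOn (fun w : ℂ => (B * M + ‖lam‖ * L) * ‖w‖⁻¹) (Metric.ball 0 r) :=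
    (integrableOn_inv_norm_ball r).const_mul _
  have hklim : ∀ w : ℂ, w ≠ 0 → Tendsto (fun ε => (dipoleKernel ε w : ℂ)) (𝓝[>] 0) (𝓝 0) := by
    intro w hw
    have hc : Continuous fun ε => dipoleKernel ε w :=
      continuous_id.div (by fun_prop) fun s => by
        have h0 := norm_pos_iff.mpr hw
        have : 0 < s ^ 2 + ‖w‖ ^ 2 := by positivity
        exact (pow_pos (Real.sqrt_pos.mpr this) 3).ne'
    exact ((Complex.continuous_ofReal.comp hc).tendsto' 0 _ (by simp [dipoleKernel])).mono_left
      nhdsWithin_le_nhds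
  -- Away from `w = 0` both `v ε` and the kernel tend to `0`. Their difference is dominated, so it
  -- contributes nothing in the limit; the whole mass comes from the kernel.
  have hdiff : Tendsto (fun ε => ∫ w in Metric.ball (0 : ℂ) r,
      ((ρ w : ℂ) * v ε w - lam * dipoleKernel ε w)) (𝓝[>] 0) (𝓝 0) := by
    have := tendsto_integral_filter_of_dominated_convergence _ hmeas hbd hbint (f := fun _ => 0) (by
      filter_upwards [hne] with w hw
      simpa using ((hlim w hw.1 hw.2).const_mul (ρ w : ℂ)).sub ((hklim w hw.2).const_mul lam))
    simpa using this
  have hk : Tendsto (fun ε => lam * ((∫ w in Metric.ball (0 : ℂ) r, dipoleKernel ε w : ℝ) : ℂ))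
      (𝓝[>] 0) (𝓝 (lam * (2 * Real.pi))) := by
    have := ((Complex.continuous_ofReal.tendsto _).comp
      (tendsto_setIntegral_dipoleKernel hr)).const_mul lam
    simpa using this
  have hsum := hdiff.add hk
  rw [zero_add] at hsum
  refine hsum.congr' ?_
  filter_upwards [hmeas, hbd, self_mem_nhdsWithin] with ε h1 h2 hε
  have h3 : IntegrableOn (fun w => (ρ w : ℂ) * v ε w - lam * dipoleKernel ε w) (Metric.ball 0 r) :=
    Integrable.mono' hbint h1 h2
  rw [← integral_complex_ofReal, ← integral_const_mul, ← integral_add h3 (hkint ε hε)]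
  simp

end Kernel

/-! ### Smooth functions on open subsets of `ℝ × S` and their slice integrals. -/

section Cylinder

variable {S : Type*} [TopologicalSpace S] [ChartedSpace ℂ S]

/-- Coordinate expression of a function on `ℝ × S`. -/
def inCoord (h : ℝ × S → ℂ) (e : HolChart S) (q : ℝ × ℂ) : ℂ := h (q.1, e.1.symm q.2)

/-- The part of the coordinate domain of `e` that is sent into `Ω ⊆ ℝ × S`. -/
def coordDom (e : HolChart S) (Ω : Set (ℝ × S)) : Set (ℝ × ℂ) :=
  {q | q.2 ∈ e.1.target ∧ (q.1, e.1.symm q.2) ∈ Ω}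

/-- Smoothness on an open subset of `ℝ × S`. -/
def SmoothOver (h : ℝ × S → ℂ) (Ω : Set (ℝ × S)) : Prop :=
  ∀ e : HolChart S, ContDiffOn ℝ ∞ (inCoord h e) (coordDom e Ω)

/-- The derivative in the direction of `ℝ`. -/
def timeDeriv (h : ℝ × S → ℂ) (p : ℝ × S) : ℂ := deriv (fun s => h (s, p.2)) p.1

theorem isOpen_coordDom (e : HolChart S) {Ω : Set (ℝ × S)} (hΩ : IsOpen Ω) :
    IsOpen (coordDom e Ω) := by
  have h1 : IsOpen {q : ℝ × ℂ | q.2 ∈ e.1.target} := e.1.open_target.preimage continuous_snd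
  have h2 : ContinuousOn (fun q : ℝ × ℂ => (q.1, e.1.symm q.2)) {q | q.2 ∈ e.1.target} :=
    continuousOn_fst.prodMk (e.1.continuousOn_symm.comp continuousOn_snd fun q hq => hq)
  exact h2.isOpen_inter_preimage h1 hΩ

variable {h : ℝ × S → ℂ} {Ω : Set (ℝ × S)}

theorem SmoothOver.contDiffAt (hh : SmoothOver h Ω) (hΩ : IsOpen Ω) {e : HolChart S} {q : ℝ × ℂ}
    (hq : q ∈ coordDom e Ω) : ContDiffAt ℝ ∞ (inCoord h e) q :=
  (hh e).contDiffAt ((isOpen_coordDom e hΩ).mem_nhds hq)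

theorem SmoothOver.differentiableAt (hh : SmoothOver h Ω) (hΩ : IsOpen Ω) {e : HolChart S}
    {q : ℝ × ℂ} (hq : q ∈ coordDom e Ω) : DifferentiableAt ℝ (inCoord h e) q :=
  (hh.contDiffAt hΩ hq).differentiableAt (by simp)

theorem hasDerivAt_prodMk_left (w : ℂ) (s : ℝ) :
    HasDerivAt (fun s : ℝ => ((s, w) : ℝ × ℂ)) ((1, 0) : ℝ × ℂ) s :=
  (hasDerivAt_id s).prodMk (hasDerivAt_const s w)

theorem SmoothOver.hasDerivAt_coord (hh : SmoothOver h Ω) (hΩ : IsOpen Ω) {e : HolChart S}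
    {q : ℝ × ℂ} (hq : q ∈ coordDom e Ω) :
    HasDerivAt (fun s => h (s, e.1.symm q.2)) (fderiv ℝ (inCoord h e) q (1, 0)) q.1 :=
  HasFDerivAt.comp_hasDerivAt (f := fun s : ℝ => ((s, q.2) : ℝ × ℂ)) (l := inCoord h e) q.1
    (hh.differentiableAt hΩ hq).hasFDerivAt (hasDerivAt_prodMk_left q.2 q.1)

theorem SmoothOver.inCoord_timeDeriv (hh : SmoothOver h Ω) (hΩ : IsOpen Ω) {e : HolChart S}
    {q : ℝ × ℂ} (hq : q ∈ coordDom e Ω) :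
    inCoord (timeDeriv h) e q = fderiv ℝ (inCoord h e) q (1, 0) :=
  (hh.hasDerivAt_coord hΩ hq).deriv

theorem SmoothOver.timeDeriv (hh : SmoothOver h Ω) (hΩ : IsOpen Ω) :
    SmoothOver (timeDeriv h) Ω := fun e =>
  (((hh e).fderiv_of_isOpen (m := ∞) (isOpen_coordDom e hΩ) (by simp)).clm_apply
    contDiffOn_const).congr fun _ hq => hh.inCoord_timeDeriv hΩ hq

variable [IsManifold 𝓘(ℂ) ω S]

theorem mem_coordDom_at {p : ℝ × S} (hp : p ∈ Ω) :
    (p.1, (HolChart.at p.2).1 p.2) ∈ coordDom (HolChart.at p.2) Ω := by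
  have hx : p.2 ∈ (HolChart.at p.2).1.source := mem_chart_source ℂ p.2
  refine ⟨(HolChart.at p.2).1.map_source hx, ?_⟩
  simpa [(HolChart.at p.2).1.left_inv hx] using hp

theorem SmoothOver.hasDerivAt (hh : SmoothOver h Ω) (hΩ : IsOpen Ω) {p : ℝ × S} (hp : p ∈ Ω) :
    HasDerivAt (fun s => h (s, p.2)) (SingularMonopole.timeDeriv h p) p.1 := by
  have h1 := hh.hasDerivAt_coord hΩ (mem_coordDom_at hp)
  simp only [(HolChart.at p.2).1.left_inv (show p.2 ∈ (HolChart.at p.2).1.source from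
    mem_chart_source ℂ p.2)] at h1
  exact h1.differentiableAt.hasDerivAt

theorem SmoothOver.continuousOn (hh : SmoothOver h Ω) (hΩ : IsOpen Ω) : ContinuousOn h Ω := by
  intro p hp
  refine ContinuousAt.continuousWithinAt ?_
  set e := HolChart.at p.2 with he
  have hx : p.2 ∈ e.1.source := mem_chart_source ℂ p.2
  have h1 : h =ᶠ[𝓝 p] fun p' => inCoord h e (p'.1, e.1 p'.2) := by
    filter_upwards [(e.1.open_source.preimage continuous_snd).mem_nhds hx] with p' hp'
    simp only [inCoord, e.1.left_inv hp', Prod.mk.eta]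
  have h2 : ContinuousAt (inCoord h e) (p.1, e.1 p.2) :=
    (hh.contDiffAt hΩ (mem_coordDom_at hp)).continuousAt
  have h3 : ContinuousAt (fun p' : ℝ × S => (p'.1, e.1 p'.2)) p :=
    continuousAt_fst.prodMk ((e.1.continuousAt hx).comp continuousAt_snd)
  exact (ContinuousAt.comp (f := fun p' : ℝ × S => (p'.1, e.1 p'.2)) (g := inCoord h e) h2 h3).congr h1.symm

theorem SmoothOver.continuousOn_slice (hh : SmoothOver h Ω) (hΩ : IsOpen Ω) {s : ℝ} {K : Set S}
    (hs : ∀ x ∈ K, (s, x) ∈ Ω) : ContinuousOn (fun x => h (s, x)) K :=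
  (hh.continuousOn hΩ).comp (by fun_prop) hs

/-- Tube lemma: if a compact part of one slice avoids the punctures, so does the same part of all
nearby slices. -/
theorem exists_tube (hΩ : IsOpen Ω) {s : ℝ} {K : Set S} (hK : IsCompact K)
    (hs : ∀ x ∈ K, (s, x) ∈ Ω) : ∃ δ > 0, ∀ s' ∈ Metric.closedBall s δ, ∀ x ∈ K, (s', x) ∈ Ω := by
  obtain ⟨u, v, hu, -, hsu, hKv, huv⟩ := generalized_tube_lemma (isCompact_singleton (x := s)) hK hΩ
    (fun p hp => by
      obtain ⟨h1, h2⟩ := hp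
      have := hs p.2 h2
      rwa [← mem_singleton_iff.mp h1] at this)
  obtain ⟨δ, hδ, hδu⟩ := Metric.nhds_basis_closedBall.mem_iff.mp (hu.mem_nhds (hsu rfl))
  exact ⟨δ, hδ, fun s' hs' x hx => huv ⟨hδu hs', hKv hx⟩⟩

theorem SmoothOver.exists_bound (hh : SmoothOver h Ω) (hΩ : IsOpen Ω) {s : ℝ} {K : Set S}
    (hK : IsCompact K) (hs : ∀ x ∈ K, (s, x) ∈ Ω) :
    ∃ δ > 0, (∀ s' ∈ Metric.closedBall s δ, ∀ x ∈ K, (s', x) ∈ Ω) ∧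
      ∃ B, ∀ s' ∈ Metric.closedBall s δ, ∀ x ∈ K, ‖h (s', x)‖ ≤ B := by
  obtain ⟨δ, hδ, h1⟩ := exists_tube hΩ hK hs
  obtain ⟨B, hB⟩ := ((isCompact_closedBall s δ).prod hK).exists_bound_of_continuousOn
    ((hh.continuousOn hΩ).mono fun p hp => h1 p.1 hp.1 p.2 hp.2)
  exact ⟨δ, hδ, h1, B, fun s' hs' x hx => hB (s', x) ⟨hs', hx⟩⟩

/-- The one-form `*dh` on the slice `{s} × S`. -/
def sliceForm (hh : SmoothOver h Ω) (hΩ : IsOpen Ω) (s : ℝ) (hs : ∀ x, (s, x) ∈ Ω) :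
    SmoothOneForm S where
  -- Precomposition with multiplication by `-i` is the Hodge star on a surface: the form takes the
  -- value `-∂_y h` on `1` and `∂_x h` on `i`. It is compatible with coordinate changes because
  -- their derivatives are complex linear.
  coord e w := (fderiv ℝ (inCoord h e) (s, w)).comp
    ((ContinuousLinearMap.inr ℝ ℝ ℂ).comp (ContinuousLinearMap.mul ℝ ℂ (-Complex.I)))
  smooth e := by
    have h1 := ((hh e).fderiv_of_isOpen (m := ∞) (isOpen_coordDom e hΩ) (by simp))
    have h2 := h1.comp (s := e.1.target) (f := fun w : ℂ => (s, w))
      (contDiff_const.prodMk contDiff_id).contDiffOn fun w hw => ⟨hw, hs _⟩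
    exact h2.clm_comp contDiffOn_const
  compatible e e' w hw := by
    have hw' := HolChart.trans_mem_target hw
    have h1 : inCoord h e =ᶠ[𝓝 (s, w)] inCoord h e' ∘ fun q => (q.1, e.trans e' q.2) := by
      filter_upwards [((e.isOpen_overlap e').preimage continuous_snd).mem_nhds hw] with q hq
      simp only [inCoord, Function.comp, HolChart.symm_trans hq]
    have h2 : HasFDerivAt (fun q : ℝ × ℂ => (q.1, e.trans e' q.2))
        ((ContinuousLinearMap.fst ℝ ℝ ℂ).prod
          ((fderiv ℝ (e.trans e') w).comp (ContinuousLinearMap.snd ℝ ℝ ℂ))) (s, w) :=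
      hasFDerivAt_fst.prodMk (HasFDerivAt.comp (f := Prod.snd) (g := e.trans e') (s, w)
        ((HolChart.contDiffAt_trans hw).differentiableAt (by simp)).hasFDerivAt hasFDerivAt_snd)
    have h3 := (hh.differentiableAt hΩ (e := e') (q := (s, e.trans e' w)) ⟨hw', hs _⟩).hasFDerivAt
    have h4 : fderiv ℝ (inCoord h e) (s, w) = _ :=
      ((h3.comp (s, w) h2).congr_of_eventuallyEq h1).fderiv
    rw [h4]
    ext v
    simp [HolChart.fderiv_trans_apply hw, mul_left_comm]

/-- In a slice `d*dh` is the Euclidean Laplacian times `dx ∧ dy`; with Stokes' theorem its integral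
vanishes. -/
theorem curl_sliceForm (hh : SmoothOver h Ω) (hΩ : IsOpen Ω) (s : ℝ) (hs : ∀ x, (s, x) ∈ Ω)
    (e : HolChart S) {w : ℂ} (hw : w ∈ e.1.target) :
    curl ((sliceForm hh hΩ s hs).coord e) w =
      fderiv ℝ (fderiv ℝ (inCoord h e)) (s, w) (0, 1) (0, 1) +
        fderiv ℝ (fderiv ℝ (inCoord h e)) (s, w) (0, Complex.I) (0, Complex.I) := by
  have h1 : DifferentiableAt ℝ (fderiv ℝ (inCoord h e)) (s, w) :=
    ((hh.contDiffAt hΩ (e := e) (q := (s, w)) ⟨hw, hs _⟩).fderiv_right (m := 1)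
      (by rw [one_add_one_eq_two]; exact ENat.LEInfty.out)).differentiableAt (by simp)
  have h2 : HasFDerivAt (fun w : ℂ => (s, w)) (ContinuousLinearMap.inr ℝ ℝ ℂ) w :=
    hasFDerivAt_prodMk_right s w
  have h3 := (h1.hasFDerivAt.comp w h2).clm_comp (hasFDerivAt_const
    ((ContinuousLinearMap.inr ℝ ℝ ℂ).comp (ContinuousLinearMap.mul ℝ ℂ (-Complex.I))) w)
  have h4 : fderiv ℝ ((sliceForm hh hΩ s hs).coord e) w = _ := h3.fderiv
  have h6 : ((0 : ℝ), (-1 : ℂ)) = -(0, 1) := by simp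
  rw [curl, h4]
  simp only [ContinuousLinearMap.comp_zero, zero_add]
  simp
  rw [h6, map_neg, neg_neg]

variable [MeasurableSpace S] [BorelSpace S]

/-- Used on a slice that contains punctures, with `K` the complement of small discs around them:
this part of the integral has no jump. -/
theorem SmoothOver.continuousAt_setIntegral (hh : SmoothOver h Ω) (hΩ : IsOpen Ω)
    (μ : Measure S) [IsFiniteMeasure μ] {s : ℝ} {K : Set S} (hK : IsCompact K)
    (hKm : MeasurableSet K) (hs : ∀ x ∈ K, (s, x) ∈ Ω) :
    ContinuousAt (fun s => ∫ x in K, h (s, x) ∂μ) s := by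
  obtain ⟨δ, hδ, h1, B, hB⟩ := hh.exists_bound hΩ hK hs
  have hn := Metric.closedBall_mem_nhds s hδ
  refine continuousAt_of_dominated (bound := fun _ => B) ?_ ?_ (integrable_const B) ?_
  · filter_upwards [hn] with s' hs'
    exact (hh.continuousOn_slice hΩ (h1 s' hs')).aestronglyMeasurable hKm
  · filter_upwards [hn] with s' hs'
    filter_upwards [ae_restrict_mem hKm] with x hx using hB s' hs' x hx
  · filter_upwards [ae_restrict_mem hKm] with x hx
    exact (hh.hasDerivAt hΩ (hs x hx)).continuousAt

theorem SmoothOver.hasDerivAt_integral [CompactSpace S] (hh : SmoothOver h Ω) (hΩ : IsOpen Ω)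
    (μ : Measure S) [IsFiniteMeasure μ] {s : ℝ} (hs : ∀ x, (s, x) ∈ Ω) :
    HasDerivAt (fun s => ∫ x, h (s, x) ∂μ) (∫ x, SingularMonopole.timeDeriv h (s, x) ∂μ) s := by
  obtain ⟨δ, hδ, h1, B, hB⟩ := (hh.timeDeriv hΩ).exists_bound hΩ isCompact_univ fun x _ => hs x
  have hn := Metric.closedBall_mem_nhds s hδ
  have hc : ∀ {k : ℝ × S → ℂ}, SmoothOver k Ω → ∀ s' ∈ Metric.closedBall s δ,
      Continuous fun x => k (s', x) := fun hk s' hs' =>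
    continuousOn_univ.mp (hk.continuousOn_slice hΩ fun x hx => h1 s' hs' x hx)
  have hss : s ∈ Metric.closedBall s δ := Metric.mem_closedBall_self hδ.le
  refine (hasDerivAt_integral_of_dominated_loc_of_deriv_le (bound := fun _ => B)
    (F := fun s x => h (s, x)) (F' := fun s x => SingularMonopole.timeDeriv h (s, x)) hn ?_ ?_ ?_ ?_ (integrable_const B) ?_).2
  · filter_upwards [hn] with s' hs' using (hc hh s' hs').aestronglyMeasurable
  · exact (hc hh s hss).integrable_of_hasCompactSupport (HasCompactSupport.of_compactSpace _)
  · exact (hc (hh.timeDeriv hΩ) s hss).aestronglyMeasurable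
  · exact Eventually.of_forall fun x s' hs' => hB s' hs' x (mem_univ x)
  · exact Eventually.of_forall fun x s' hs' =>
      hh.hasDerivAt hΩ (h1 s' hs' x (mem_univ x))

end Cylinder

/-! ### Harmonic functions on the product with point singularities. -/

section PuncturedHarmonic

variable {T : ℝ} {S : Type*}

/-- The pullback to `ℝ × S` of a function on `S¹ × S`. -/
def liftFun (f : AddCircle T × S → ℂ) (p : ℝ × S) : ℂ := f ((p.1 : AddCircle T), p.2)

/-- The preimage in `ℝ × S` of the punctured product. -/
def puncturedCylinder (T : ℝ) {N : ℕ} (t : Fin N → ℝ) (z : Fin N → S) : Set (ℝ × S) :=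
  {p | ((p.1 : AddCircle T), p.2) ∈ puncturedProduct T t z}

variable [TopologicalSpace S] [ChartedSpace ℂ S] {N : ℕ}

theorem isOpen_puncturedProduct [T2Space S] (t : Fin N → ℝ) (z : Fin N → S) :
    IsOpen (puncturedProduct T t z) := by
  have : puncturedProduct T t z = ⋂ j, {((t j : AddCircle T), z j)}ᶜ := by
    ext p
    simp [puncturedProduct]
  rw [this]
  exact isOpen_iInter_of_finite fun j => isOpen_compl_singleton

theorem isOpen_puncturedCylinder [T2Space S] (t : Fin N → ℝ) (z : Fin N → S) :
    IsOpen (puncturedCylinder T t z) :=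
  (isOpen_puncturedProduct t z).preimage
    (((AddCircle.continuous_mk' T).comp continuous_fst).prodMk continuous_snd)

/-- A function on the punctured product that is harmonic for the product metric, with singularities
`iκ / 2R` at the punctures. -/
structure IsPuncturedHarmonic (g : HermitianMetric S) (t : Fin N → ℝ) (z : Fin N → S)
    (κ : Fin N → ℂ) (f : AddCircle T × S → ℂ) : Prop where
  smooth : SmoothOver (liftFun f) (puncturedCylinder T t z)
  harmonic : ∀ e : HolChart S, ∀ q ∈ coordDom e (puncturedCylinder T t z),
    g.density e q.2 * fderiv ℝ (fderiv ℝ (inCoord (liftFun f) e)) q (1, 0) (1, 0) +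
      (fderiv ℝ (fderiv ℝ (inCoord (liftFun f) e)) q (0, 1) (0, 1) +
        fderiv ℝ (fderiv ℝ (inCoord (liftFun f) e)) q (0, Complex.I) (0, Complex.I)) = 0
  singular : ∀ j, ∃ e : HolChart S, z j ∈ e.1.source ∧ e.1 (z j) = 0 ∧ g.density e 0 = 1 ∧
    ∃ c : ℝ, 0 < c ∧
      (∀ q ∈ puncturedBall (t j) c, q ∈ coordDom e (puncturedCylinder T t z)) ∧
      ∃ M : ℝ, ∀ q ∈ puncturedBall (t j) c,
        ‖inCoord (liftFun f) e q - Complex.I * κ j / (2 * radius (t j) q : ℝ)‖ ≤ M ∧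
        ‖(radius (t j) q : ℂ) * fderiv ℝ (inCoord (liftFun f) e) q (1, 0) +
          ((q.1 - t j) / radius (t j) q : ℝ) * inCoord (liftFun f) e q‖ ≤ M

/-- The function `h - s ∂h/∂s`. -/
def legendre (h : ℝ × S → ℂ) (p : ℝ × S) : ℂ := h p - p.1 * timeDeriv h p

/-- `F`, `F'` are values of the function at times `τ ± ε`, and `G`, `G'` its time derivatives. The
bounds on `b`, `b'` come from `∂_t (R f) = O(1)`; they give `G = -i κ ε / 2R³ + O(1/R)` and the
opposite sign for `G'`. In the jump the leading terms have coefficients `τ + ε` and `τ - ε`, which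
add up to exactly `2τ`; all else is `O(1/R)`. -/
theorem norm_dipole_jump_le {a b a' b' F G F' G' κ : ℂ} {τ ε R M c : ℝ} (hε : 0 < ε) (hεR : ε ≤ R)
    (hRc : R ≤ c) (ha : F - Complex.I * κ / (2 * R : ℝ) = a) (ha' : F' - Complex.I * κ / (2 * R : ℝ) = a')
    (hb : (R : ℂ) * G + (ε / R : ℝ) * F = b) (hb' : (R : ℂ) * G' + (-ε / R : ℝ) * F' = b')
    (hM : ‖a‖ ≤ M ∧ ‖b‖ ≤ M ∧ ‖a'‖ ≤ M ∧ ‖b'‖ ≤ M) :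
    ‖(F - (τ + ε : ℝ) * G) - (F' - (τ - ε : ℝ) * G') -
      Complex.I * κ * τ * (ε / R ^ 3 : ℝ)‖ ≤ (2 * M * c + 4 * (|τ| + c) * M) * R⁻¹ := by
  have hR : 0 < R := hε.trans_le hεR
  have hRC : (R : ℂ) ≠ 0 := Complex.ofReal_ne_zero.mpr hR.ne'
  obtain ⟨h1, h2, h3, h4⟩ := hM
  have hM0 : 0 ≤ M := (norm_nonneg _).trans h1
  have e1 : (F - (τ + ε : ℝ) * G) - (F' - (τ - ε : ℝ) * G') -
      Complex.I * κ * τ * (ε / R ^ 3 : ℝ) =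
      (a - a') - (τ + ε : ℝ) * (b * (R⁻¹ : ℝ) - (ε / R : ℝ) * a * (R⁻¹ : ℝ)) +
        (τ - ε : ℝ) * (b' * (R⁻¹ : ℝ) + (ε / R : ℝ) * a' * (R⁻¹ : ℝ)) := by
    rw [← ha, ← ha', ← hb, ← hb']
    push_cast
    field_simp
    ring
  have hx : ε / R ≤ 1 := (div_le_one hR).mpr hεR
  have hRi : 0 < R⁻¹ := inv_pos.mpr hR
  have bd : ∀ {y x : ℂ}, ‖y‖ ≤ M → ‖x‖ ≤ M → ‖y * (R⁻¹ : ℝ)‖ + ‖((ε / R : ℝ) : ℂ) * x * (R⁻¹ : ℝ)‖ ≤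
      2 * M * R⁻¹ := by
    intro y x hy hx'
    rw [norm_mul, norm_mul, norm_mul, Complex.norm_real, Complex.norm_real, Real.norm_of_nonneg hRi.le,
      Real.norm_of_nonneg (div_nonneg hε.le hR.le)]
    have e3 : ε / R * ‖x‖ ≤ M := (mul_le_of_le_one_left (norm_nonneg _) hx).trans hx'
    nlinarith
  have t1 : ‖((τ + ε : ℝ) : ℂ)‖ ≤ |τ| + c := by
    rw [Complex.norm_real, Real.norm_eq_abs]
    exact (abs_add_le _ _).trans (by rw [abs_of_pos hε]; linarith)
  have t2 : ‖((τ - ε : ℝ) : ℂ)‖ ≤ |τ| + c := by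
    rw [Complex.norm_real, Real.norm_eq_abs]
    exact (abs_sub _ _).trans (by rw [abs_of_pos hε]; linarith)
  have n1 := (norm_sub_le (b * (R⁻¹ : ℝ)) ((ε / R : ℝ) * a * (R⁻¹ : ℝ))).trans (bd h2 h1)
  have n2 := (norm_add_le (b' * (R⁻¹ : ℝ)) ((ε / R : ℝ) * a' * (R⁻¹ : ℝ))).trans (bd h4 h3)
  have m1 := mul_le_mul t1 n1 (norm_nonneg _) (by linarith [norm_nonneg ((τ + ε : ℝ) : ℂ)])
  have m2 := mul_le_mul t2 n2 (norm_nonneg _) (by linarith [norm_nonneg ((τ + ε : ℝ) : ℂ)])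
  rw [← norm_mul] at m1 m2
  have n3 : ‖a - a'‖ ≤ 2 * M * c * R⁻¹ := by
    refine (norm_sub_le _ _).trans ((add_le_add h1 h3).trans ?_)
    have : 1 ≤ c * R⁻¹ := by rwa [← div_eq_mul_inv, one_le_div hR]
    nlinarith
  rw [e1]
  refine (norm_add_le _ _).trans ((add_le_add_left (norm_sub_le _ _) _).trans ?_)
  nlinarith

variable [IsManifold 𝓘(ℂ) ω S] {g : HermitianMetric S} {t : Fin N → ℝ} {z : Fin N → S}
  {κ : Fin N → ℂ} {f : AddCircle T × S → ℂ}

theorem SmoothOver.legendre {h : ℝ × S → ℂ} {Ω : Set (ℝ × S)} (hh : SmoothOver h Ω)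
    (hΩ : IsOpen Ω) : SmoothOver (legendre h) Ω := fun e =>
  (hh e).sub ((Complex.ofRealCLM.contDiff.comp contDiff_fst).contDiffOn.mul (hh.timeDeriv hΩ e))

/-- The two first order terms cancel, so only the second time derivative, which harmonicity
controls, is left. -/
theorem SmoothOver.timeDeriv_legendre {h : ℝ × S → ℂ} {Ω : Set (ℝ × S)} (hh : SmoothOver h Ω)
    (hΩ : IsOpen Ω) {p : ℝ × S} (hp : p ∈ Ω) : SingularMonopole.timeDeriv (SingularMonopole.legendre h) p =
      -(p.1 * SingularMonopole.timeDeriv (SingularMonopole.timeDeriv h) p) := by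
  have h1 := hh.hasDerivAt hΩ hp
  have h2 := (hh.timeDeriv hΩ).hasDerivAt hΩ hp
  have h3 : HasDerivAt (fun s : ℝ => (s : ℂ)) 1 p.1 := Complex.ofRealCLM.hasDerivAt
  have h4 := (h1.sub (h3.mul h2)).deriv
  refine h4.trans ?_
  simp

theorem SmoothOver.inCoord_timeDeriv_timeDeriv {h : ℝ × S → ℂ} {Ω : Set (ℝ × S)}
    (hh : SmoothOver h Ω) (hΩ : IsOpen Ω) {e : HolChart S} {q : ℝ × ℂ} (hq : q ∈ coordDom e Ω) :
    inCoord (SingularMonopole.timeDeriv (SingularMonopole.timeDeriv h)) e q =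
      fderiv ℝ (fderiv ℝ (inCoord h e)) q (1, 0) (1, 0) := by
  rw [(hh.timeDeriv hΩ).inCoord_timeDeriv hΩ hq]
  have h1 : inCoord (SingularMonopole.timeDeriv h) e =ᶠ[𝓝 q] fun q => fderiv ℝ (inCoord h e) q (1, 0) := by
    filter_upwards [(isOpen_coordDom e hΩ).mem_nhds hq] with q' hq' using hh.inCoord_timeDeriv hΩ hq'
  rw [h1.fderiv_eq, fderiv_clm_apply (((hh.contDiffAt hΩ hq).fderiv_right (m := 1)
    (by rw [one_add_one_eq_two]; exact ENat.LEInfty.out)).differentiableAt (by simp)) (by fun_prop)]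
  simp

variable [T2Space S]

/-- Harmonicity trades the second time derivative for the slice Laplacian, which is exact. -/
theorem IsPuncturedHarmonic.curlDensity_sliceForm (hf : IsPuncturedHarmonic g t z κ f) {s : ℝ}
    (hs : ∀ x, (s, x) ∈ puncturedCylinder T t z) (x : S) :
    (sliceForm hf.smooth (isOpen_puncturedCylinder t z) s hs).curlDensity g x =
      -timeDeriv (timeDeriv (liftFun f)) (s, x) := by
  have hΩ := isOpen_puncturedCylinder (T := T) t z
  have hx : x ∈ (HolChart.at x).1.source := mem_chart_source ℂ x
  have ht := (HolChart.at x).1.map_source hx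
  have hq : (s, (HolChart.at x).1 x) ∈ coordDom (HolChart.at x) (puncturedCylinder T t z) := ⟨ht, hs _⟩
  have h1 := hf.harmonic _ _ hq
  rw [← hf.smooth.inCoord_timeDeriv_timeDeriv hΩ hq, ← curl_sliceForm hf.smooth hΩ s hs _ ht,
    inCoord, (HolChart.at x).1.left_inv hx] at h1
  rw [SmoothOneForm.curlDensity, div_eq_iff (g.density_ne_zero ht)]
  linear_combination h1

variable [CompactSpace S] [MeasurableSpace S] [BorelSpace S]

theorem IsPuncturedHarmonic.hasDerivAt_integral_legendre (hf : IsPuncturedHarmonic g t z κ f) {s : ℝ}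
    (hs : ∀ x, (s, x) ∈ puncturedCylinder T t z) :
    HasDerivAt (fun s => ∫ x, legendre (liftFun f) (s, x) ∂g.area) 0 s := by
  have := g.isFiniteMeasure_area
  have hΩ := isOpen_puncturedCylinder (T := T) t z
  have h1 := (hf.smooth.legendre hΩ).hasDerivAt_integral hΩ g.area hs
  have h2 : ∀ x, timeDeriv (legendre (liftFun f)) (s, x) =
      s * (sliceForm hf.smooth hΩ s hs).curlDensity g x := fun x => by
    rw [hf.smooth.timeDeriv_legendre hΩ (hs x), hf.curlDensity_sliceForm hs]
    ring
  simp_rw [h2] at h1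
  rwa [integral_const_mul, SmoothOneForm.integral_curlDensity, mul_zero] at h1

/-- The contribution of one puncture to the jump. It is stated for arbitrarily small `W` so that
discs around several punctures in one slice can be kept disjoint. -/
theorem IsPuncturedHarmonic.exists_nhds_tendsto (hf : IsPuncturedHarmonic g t z κ f) (j : Fin N)
    {V : Set S} (hV : V ∈ 𝓝 (z j)) :
    ∃ W, IsOpen W ∧ z j ∈ W ∧ W ⊆ V ∧ Tendsto (fun ε => ∫ x in W,
      (legendre (liftFun f) (t j + ε, x) - legendre (liftFun f) (t j - ε, x)) ∂g.area) (𝓝[>] 0)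
      (𝓝 (Complex.I * κ j * t j * (2 * Real.pi))) := by
  have hΩ := isOpen_puncturedCylinder (T := T) t z
  have hu := hf.smooth.legendre hΩ
  obtain ⟨e, hze, he0, hρ0, c, hc, hball, M, hM⟩ := hf.singular j
  have ht0 : (0 : ℂ) ∈ e.1.target := he0 ▸ e.1.map_source hze
  have hz0 : e.1.symm 0 = z j := by rw [← he0, e.1.left_inv hze]
  -- a disc on which everything is controlled
  have hdiff : DifferentiableAt ℝ (g.density e) 0 :=
    ((g.density_smooth e).contDiffAt (e.1.open_target.mem_nhds ht0)).differentiableAt (by simp)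
  -- Since the density is `1` at the centre and differentiable, it is `1 + O(|w|)` near it.
  obtain ⟨L, hL⟩ := hdiff.isBigO_sub.bound
  have hV' : e.1.symm ⁻¹' V ∈ 𝓝 (0 : ℂ) := (e.1.continuousAt_symm ht0) (hz0.symm ▸ hV)
  obtain ⟨r₀, hr₀, hsub⟩ := Metric.mem_nhds_iff.mp
    (inter_mem (inter_mem hL hV') (e.1.open_target.mem_nhds ht0))
  -- With `|w|` and `|s - t j|` both below `c / 2`, the point stays in the ball of radius `c`.
  set r := min r₀ (c / 2) with hr_def
  have hr : 0 < r := lt_min hr₀ (by linarith)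
  have hrc : r ≤ c / 2 := min_le_right _ _
  have hB : Metric.ball (0 : ℂ) r ⊆ Metric.ball 0 r₀ := Metric.ball_subset_ball (min_le_left _ _)
  have hBt : Metric.ball (0 : ℂ) r ⊆ e.1.target := fun w hw => (hsub (hB hw)).2
  have hρL : ∀ w ∈ Metric.ball (0 : ℂ) r, |g.density e w - 1| ≤ L * ‖w‖ := fun w hw => by
    simpa [hρ0] using (hsub (hB hw)).1.1
  have hε : ∀ᶠ ε in 𝓝[>] (0 : ℝ), 0 < ε ∧ ε < c / 2 := Ioo_mem_nhdsGT (by linarith)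
  have hmem : ∀ s w, |s - t j| < c / 2 → w ∈ Metric.ball (0 : ℂ) r → (s ≠ t j ∨ w ≠ 0) →
      (s, w) ∈ puncturedBall (t j) c := by
    intro s w hs hw hne
    have hw' : ‖w‖ < c / 2 := (mem_ball_zero_iff.mp hw).trans_le hrc
    refine ⟨Real.sqrt_pos.mpr ?_, (Real.sqrt_lt' hc).mpr ?_⟩
    · rcases hne with h | h
      · have := sub_ne_zero.mpr h
        positivity
      · have := norm_pos_iff.mpr h
        positivity
    · have h1 : (s - t j) ^ 2 < (c / 2) ^ 2 := sq_lt_sq' (abs_lt.mp hs).1 (abs_lt.mp hs).2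
      have h2 : ‖w‖ ^ 2 < (c / 2) ^ 2 := pow_lt_pow_left₀ hw' (norm_nonneg _) two_ne_zero
      simp only
      nlinarith
  refine ⟨e.1.symm '' Metric.ball 0 r, e.isOpen_image_symm Metric.isOpen_ball hBt,
    ⟨0, Metric.mem_ball_self hr, hz0⟩, ?_, ?_⟩
  · rintro _ ⟨w, hw, rfl⟩
    exact (hsub (hB hw)).1.2
  have hcont : ∀ s, |s - t j| < c / 2 → s ≠ t j →
      ContinuousOn (fun w => inCoord (legendre (liftFun f)) e (s, w)) (Metric.ball 0 r) :=
    fun s hs hne => (hu e).continuousOn.comp (by fun_prop) fun w hw =>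
      hball _ (hmem s w hs hw (Or.inl hne))
  have hconv := tendsto_setIntegral_of_near_dipole hr (ρ := g.density e)
    (v := fun ε w => inCoord (legendre (liftFun f)) e (t j + ε, w) -
      inCoord (legendre (liftFun f)) e (t j - ε, w))
    (lam := Complex.I * κ j * t j) (L := L) (M := 2 * M * c + 4 * (|t j| + c) * M) (B := 1 + |L| * r)
    ((g.density_smooth e).continuousOn.mono hBt) ?_ hρL ?_ ?_ ?_
  · refine hconv.congr' ?_
    filter_upwards [hε] with ε hε
    refine (g.setIntegral_area e Metric.isOpen_ball hBt (φ := fun x =>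
      legendre (liftFun f) (t j + ε, x) - legendre (liftFun f) (t j - ε, x)) ?_).symm
    have h1 : ∀ s, |s - t j| < c / 2 → s ≠ t j → ContinuousOn
        (fun x => legendre (liftFun f) (s, x)) (e.1.symm '' Metric.ball 0 r) := by
      intro s hs hne
      refine hu.continuousOn_slice hΩ ?_
      rintro _ ⟨w, hw, rfl⟩
      exact (hball _ (hmem s w hs hw (Or.inl hne))).2
    exact ((h1 _ (by simpa [abs_of_pos hε.1] using hε.2) (by simpa using hε.1.ne')).sub
      (h1 _ (by simpa [abs_of_pos hε.1] using hε.2) (by simpa using hε.1.ne'))).aestronglyMeasurable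
      (e.isOpen_image_symm Metric.isOpen_ball hBt).measurableSet
  · intro w hw
    have h1 := hρL w hw
    have h2 : ‖w‖ ≤ r := (mem_ball_zero_iff.mp hw).le
    have h3 : L * ‖w‖ ≤ |L| * r :=
      (mul_le_mul_of_nonneg_right (le_abs_self L) (norm_nonneg _)).trans
        (mul_le_mul_of_nonneg_left h2 (abs_nonneg L))
    calc |g.density e w| = |1 + (g.density e w - 1)| := by ring_nf
      _ ≤ |1| + |g.density e w - 1| := abs_add_le _ _
      _ ≤ _ := by rw [abs_one]; linarith
  · filter_upwards [hε] with ε hε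
    exact (hcont _ (by simpa [abs_of_pos hε.1] using hε.2) (by simpa using hε.1.ne')).sub
      (hcont _ (by simpa [abs_of_pos hε.1] using hε.2) (by simpa using hε.1.ne'))
  · filter_upwards [hε] with ε hε w hw hw0
    have hp := hmem (t j + ε) w (by simpa [abs_of_pos hε.1] using hε.2) hw (Or.inr hw0)
    have hm := hmem (t j - ε) w (by simpa [abs_of_pos hε.1] using hε.2) hw (Or.inr hw0)
    have e1 : radius (t j) (t j + ε, w) = Real.sqrt (ε ^ 2 + ‖w‖ ^ 2) := by simp [radius]
    have e2 : radius (t j) (t j - ε, w) = Real.sqrt (ε ^ 2 + ‖w‖ ^ 2) := by simp [radius]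
    obtain ⟨p1, p2⟩ := hM _ hp
    obtain ⟨m1, m2⟩ := hM _ hm
    have hRc := hp.2
    have hMn : 0 ≤ M := (norm_nonneg _).trans p1
    rw [e1] at p1 p2 hRc
    rw [e2] at m1 m2
    simp only [add_sub_cancel_left, sub_sub_cancel_left] at p2 m2
    have hkey := norm_dipole_jump_le (τ := t j) hε.1 (Real.le_sqrt_of_sq_le
      (by nlinarith [sq_nonneg ‖w‖] : ε ^ 2 ≤ ε ^ 2 + ‖w‖ ^ 2)) hRc.le rfl rfl rfl rfl ⟨p1, p2, m1, m2⟩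
    have hle : (Real.sqrt (ε ^ 2 + ‖w‖ ^ 2))⁻¹ ≤ ‖w‖⁻¹ :=
      inv_anti₀ (norm_pos_iff.mpr hw0) (norm_le_sqrt_add ε w)
    have hl : ∀ s, (s, w) ∈ puncturedBall (t j) c → inCoord (legendre (liftFun f)) e (s, w) =
        inCoord (liftFun f) e (s, w) - (s : ℝ) * fderiv ℝ (inCoord (liftFun f) e) (s, w) (1, 0) :=
      fun s hs => by
        rw [← hf.smooth.inCoord_timeDeriv hΩ (hball _ hs)]
        rfl
    rw [hl _ hp, hl _ hm]
    exact hkey.trans (mul_le_mul_of_nonneg_left hle (by positivity))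
  -- Off the centre of the disc the function is smooth across the time `t j`, so it has no pointwise
  -- jump.
  · intro w hw hw0
    have h1 : ContinuousAt (fun s => inCoord (legendre (liftFun f)) e (s, w)) (t j) :=
      (hu.hasDerivAt_coord hΩ (hball (t j, w) (hmem (t j) w (by simpa using hc) hw
        (Or.inr hw0)))).continuousAt
    have h2 : ContinuousAt (fun ε => inCoord (legendre (liftFun f)) e (t j + ε, w)) 0 :=
      ContinuousAt.comp (g := fun s => inCoord (legendre (liftFun f)) e (s, w))
        (f := fun ε => t j + ε) (by simpa using h1) (by fun_prop)
    have h3 : ContinuousAt (fun ε => inCoord (legendre (liftFun f)) e (t j - ε, w)) 0 :=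
      ContinuousAt.comp (g := fun s => inCoord (legendre (liftFun f)) e (s, w))
        (f := fun ε => t j - ε) (by simpa using h1) (by fun_prop)
    have h4 := h2.tendsto.sub h3.tendsto
    simp only [add_zero, sub_zero, sub_self] at h4
    exact h4.mono_left nhdsWithin_le_nhds

theorem mem_puncturedCylinder_of_ne {s : ℝ} (hs : ∀ j, (s : AddCircle T) ≠ t j) (x : S) :
    (s, x) ∈ puncturedCylinder T t z := fun j h => hs j (congrArg Prod.fst h)

/-- Two reals with the same class differ by a multiple of `T`; at distance below `T` the multiple is
zero. -/
theorem coe_eq_coe_imp_eq {a b : ℝ} (hab : |a - b| < T) (h : (a : AddCircle T) = b) : a = b := by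
  have h1 : ((a - b : ℝ) : AddCircle T) = 0 := by simp [h]
  obtain ⟨n, hn⟩ := AddCircle.coe_eq_zero_iff T |>.mp h1
  rw [zsmul_eq_mul] at hn
  have hT : 0 < T := (abs_nonneg _).trans_lt hab
  rw [← hn, abs_mul, abs_of_pos hT] at hab
  have h2 : |(n : ℝ)| < 1 := by
    by_contra h3
    exact absurd hab (not_lt.mpr (le_mul_of_one_le_left hT.le (not_lt.mp h3)))
  have h3 : n = 0 := by
    rw [← Int.abs_lt_one_iff]
    exact_mod_cast h2
  rw [h3] at hn
  linarith [hn.symm.trans (by simp : ((0 : ℤ) : ℝ) * T = 0)]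

theorem eventually_forall_coe_ne (hT : 0 < T) (x : ℝ) :
    ∀ᶠ s : ℝ in 𝓝[≠] x, ∀ j, (s : AddCircle T) ≠ t j := by
  refine eventually_all.mpr fun j => ?_
  by_cases hx : (x : AddCircle T) = t j
  · have h1 : ∀ᶠ s in 𝓝 x, |s - x| < T := by
      filter_upwards [Metric.ball_mem_nhds x hT] with s hs
      simpa [Real.dist_eq] using hs
    filter_upwards [nhdsWithin_le_nhds h1, self_mem_nhdsWithin] with s hs hne h
    exact hne (coe_eq_coe_imp_eq hs (h.trans hx.symm))
  · exact nhdsWithin_le_nhds ((AddCircle.continuous_mk' T).continuousAt.eventually_ne hx)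

/-- Several punctures may share the time `t i`. Their discs each contribute a jump, and the rest of
the slice is compact and free of punctures, so it contributes none. -/
theorem IsPuncturedHarmonic.tendsto_jump (hT : 0 < T) (ht : ∀ j, t j ∈ Ioo 0 T)
    (hp : Function.Injective fun j => (t j, z j)) (hf : IsPuncturedHarmonic g t z κ f) (i : Fin N) :
    Tendsto (fun ε => ∫ x, legendre (liftFun f) (t i + ε, x) ∂g.area -
      ∫ x, legendre (liftFun f) (t i - ε, x) ∂g.area) (𝓝[>] 0)
      (𝓝 (∑ j with t j = t i, Complex.I * κ j * t j * (2 * Real.pi))) := by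
  have := g.isFiniteMeasure_area
  have hΩ := isOpen_puncturedCylinder (T := T) t z
  have hu := hf.smooth.legendre hΩ
  obtain ⟨U, hU, hUd⟩ := (finite_range z).t2_separation
  choose W hWo hzW hWU hWlim using fun j =>
    hf.exists_nhds_tendsto j ((hU (z j)).2.mem_nhds (hU (z j)).1)
  set J : Finset (Fin N) := {j | t j = t i} with hJ
  have hdisj : (J : Set (Fin N)).PairwiseDisjoint W := by
    intro a ha b hb hab
    have hta : t a = t i := by simpa [hJ] using ha
    have htb : t b = t i := by simpa [hJ] using hb
    -- Distinct punctures at the same time have distinct `z`, by injectivity.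
    refine (hUd (mem_range_self a) (mem_range_self b) fun hz => hab (hp ?_)).mono (hWU a) (hWU b)
    simp only [hta, htb, hz]
  set K : Set S := (⋃ j ∈ J, W j)ᶜ with hK
  have hWopen : IsOpen (⋃ j ∈ J, W j) := isOpen_biUnion fun j _ => hWo j
  have hKc : IsCompact K := hWopen.isClosed_compl.isCompact
  have hKm : MeasurableSet K := hWopen.measurableSet.compl
  have hKΩ : ∀ x ∈ K, (t i, x) ∈ puncturedCylinder T t z := by
    intro x hx j hj
    have h1 : t i = t j := coe_eq_coe_imp_eq (by
      have h2 := ht i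
      have h3 := ht j
      exact abs_lt.mpr ⟨by linarith [h2.1, h3.2], by linarith [h2.2, h3.1]⟩) (congrArg Prod.fst hj)
    have h2 : x = z j := congrArg Prod.snd hj
    exact hx (mem_biUnion (show j ∈ J by simp [hJ, h1]) (h2 ▸ hzW j))
  have hadd : Tendsto (fun ε => t i + ε) (𝓝[>] 0) (𝓝[≠] (t i)) :=
    tendsto_nhdsWithin_iff.mpr ⟨(Continuous.tendsto' (by fun_prop) _ _ (by simp)).mono_left
      nhdsWithin_le_nhds, by
        filter_upwards [self_mem_nhdsWithin] with ε hε
        simpa using (ne_of_gt hε)⟩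
  have hsub : Tendsto (fun ε => t i - ε) (𝓝[>] 0) (𝓝[≠] (t i)) :=
    tendsto_nhdsWithin_iff.mpr ⟨(Continuous.tendsto' (by fun_prop) _ _ (by simp)).mono_left
      nhdsWithin_le_nhds, by
        filter_upwards [self_mem_nhdsWithin] with ε hε
        simpa using (ne_of_gt hε)⟩
  have hKlim : Tendsto (fun ε => ∫ x in K, legendre (liftFun f) (t i + ε, x) ∂g.area -
      ∫ x in K, legendre (liftFun f) (t i - ε, x) ∂g.area) (𝓝[>] 0) (𝓝 0) := by
    have h1 := (hu.continuousAt_setIntegral hΩ g.area hKc hKm hKΩ).tendsto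
    have h2 := (h1.comp (hadd.mono_right nhdsWithin_le_nhds)).sub
      (h1.comp (hsub.mono_right nhdsWithin_le_nhds))
    rwa [sub_self] at h2
  have hlim := (tendsto_finsetSum J fun j _ => hWlim j).add hKlim
  rw [add_zero] at hlim
  refine hlim.congr' ?_
  filter_upwards [hadd.eventually (eventually_forall_coe_ne (t := t) hT (t i)),
    hsub.eventually (eventually_forall_coe_ne (t := t) hT (t i))] with ε h1 h2
  have hint : ∀ s : ℝ, (∀ j, (s : AddCircle T) ≠ t j) →
      Integrable (fun x => legendre (liftFun f) (s, x)) g.area := fun s hs =>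
    (continuousOn_univ.mp (hu.continuousOn_slice hΩ fun x _ =>
      mem_puncturedCylinder_of_ne hs x)).integrable_of_hasCompactSupport
        (HasCompactSupport.of_compactSpace _)
  have i1 := hint _ h1
  have i2 := hint _ h2
  have i3 : Integrable (fun x => legendre (liftFun f) (t i + ε, x) - legendre (liftFun f) (t i - ε, x))
      g.area := i1.sub i2
  rw [← integral_sub i1.integrableOn i2.integrableOn, ← integral_sub i1 i2,
    ← integral_add_compl hWopen.measurableSet i3,
    integral_biUnion_finset J (fun j _ => (hWo j).measurableSet) hdisj fun j _ => i3.integrableOn]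
  congr 1
  refine Finset.sum_congr rfl fun j hj => ?_
  have hj' : t j = t i := by simpa [hJ] using hj
  rw [hj']

/-- The time derivative at `0` of a harmonic function with point singularities, integrated over the
slice `{0} × S`. -/
theorem IsPuncturedHarmonic.mul_integral_timeDeriv (hT : 0 < T) (ht : ∀ j, t j ∈ Ioo 0 T)
    (hp : Function.Injective fun j => (t j, z j)) (hf : IsPuncturedHarmonic g t z κ f) :
    T * ∫ x, timeDeriv (liftFun f) (0, x) ∂g.area =
      -(2 * Real.pi * Complex.I * ∑ j, κ j * t j) := by
  have := g.isFiniteMeasure_area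
  have hΩ := isOpen_puncturedCylinder (T := T) t z
  have h0 : ∀ x ∈ Icc 0 T, (∀ j, t j ≠ x) → ∀ j, (x : AddCircle T) ≠ t j := by
    intro x hx hxt j h
    have h2 := ht j
    exact hxt j (coe_eq_coe_imp_eq (abs_lt.mpr ⟨by linarith [h2.2, hx.1], by linarith [h2.1, hx.2]⟩)
      h).symm
  have hder : ∀ s : ℝ, (∀ j, (s : AddCircle T) ≠ t j) →
      HasDerivAt (fun s => ∫ x, legendre (liftFun f) (s, x) ∂g.area) 0 s := fun s hs =>
    hf.hasDerivAt_integral_legendre (mem_puncturedCylinder_of_ne hs)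
  have hsum := sub_eq_sum_jumps hT ht (fun j => Complex.I * κ j * t j * (2 * Real.pi))
    (p := fun s => ∫ x, legendre (liftFun f) (s, x) ∂g.area)
    (fun x _ => (eventually_forall_coe_ne hT x).mono hder)
    (fun x hx hxt => (hder x (h0 x hx hxt)).continuousAt)
    (hf.tendsto_jump hT ht hp)
  -- By periodicity the slices `T` and `0` carry the same data; the slice integrals of `legendre`
  -- differ only through the explicit factor `s`, equal to `T` at one end and `0` at the other.
  have hper : ∀ x, liftFun f (T, x) = liftFun f (0, x) := fun x => by
    simp [liftFun, AddCircle.coe_period]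
  have hper' : ∀ x, timeDeriv (liftFun f) (T, x) = timeDeriv (liftFun f) (0, x) := fun x => by
    have h1 : (fun s : ℝ => liftFun f (s, x)) = fun s => liftFun f (s + T, x) := by
      ext s
      simp [liftFun]
    have h2 : timeDeriv (liftFun f) (0, x) = deriv (fun s : ℝ => liftFun f (s + T, x)) 0 := by
      rw [← h1]
      rfl
    rw [h2, deriv_comp_add_const (fun s : ℝ => liftFun f (s, x)) T 0, zero_add]
    rfl
  have hc : ∀ {k : ℝ × S → ℂ}, SmoothOver k (puncturedCylinder T t z) →
      Integrable (fun x => k (0, x)) g.area := fun hk =>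
    (continuousOn_univ.mp (hk.continuousOn_slice hΩ fun x _ => mem_puncturedCylinder_of_ne
      (h0 0 ⟨le_rfl, hT.le⟩ fun j => (ht j).1.ne') x)).integrable_of_hasCompactSupport
        (HasCompactSupport.of_compactSpace _)
  have hdiff : ∫ x, legendre (liftFun f) (T, x) ∂g.area - ∫ x, legendre (liftFun f) (0, x) ∂g.area =
      -(T * ∫ x, timeDeriv (liftFun f) (0, x) ∂g.area) := by
    have h1 : ∀ x, legendre (liftFun f) (T, x) =
        liftFun f (0, x) - T * timeDeriv (liftFun f) (0, x) := fun x => by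
      simp only [legendre, hper, hper']
    have h2 : ∀ x, legendre (liftFun f) (0, x) = liftFun f (0, x) := fun x => by simp [legendre]
    simp_rw [h1, h2]
    rw [integral_sub (hc hf.smooth) ((hc (hf.smooth.timeDeriv hΩ)).const_mul _), integral_const_mul]
    ring
  rw [hdiff] at hsum
  have h3 : ∑ j, Complex.I * κ j * t j * (2 * Real.pi) =
      2 * Real.pi * Complex.I * ∑ j, κ j * t j := by
    rw [Finset.mul_sum]
    exact Finset.sum_congr rfl fun j _ => by ring
  rw [← h3, ← hsum, neg_neg]

end PuncturedHarmonic

/-! ### Traces of curvature, covariant derivative and unitary conjugates. -/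

section Trace

/-- The trace as a real continuous linear map. -/
def traceCLM (n : ℕ) : Mat n →L[ℝ] ℂ := LinearMap.toContinuousLinearMap (Matrix.traceLinearMap (Fin n) ℝ ℂ)

@[simp]
theorem traceCLM_apply {n : ℕ} (A : Mat n) : traceCLM n A = A.trace := rfl

variable {V : Type*} [NormedAddCommGroup V] [NormedSpace ℝ V] {n : ℕ}

/-- The trace of a matrix valued one-form. -/
def traceForm (A : V → V →L[ℝ] Mat n) (v : V) : V →L[ℝ] ℂ := (traceCLM n).comp (A v)

theorem fderiv_traceForm {A : V → V →L[ℝ] Mat n} {v : V} (hA : DifferentiableAt ℝ A v) (u u' : V) :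
    fderiv ℝ (traceForm A) v u u' = (fderiv ℝ A v u u').trace := by
  have h : fderiv ℝ (traceForm A) v = _ := ((hasFDerivAt_const (traceCLM n) v).clm_comp hA.hasFDerivAt).fderiv
  rw [h]
  simp

/-- The quadratic term of the curvature is a commutator, so `tr F = d(tr A)`. -/
theorem trace_curvature {A : V → V →L[ℝ] Mat n} {v : V} (hA : DifferentiableAt ℝ A v) (u u' : V) :
    (curvature A v u u').trace =
      fderiv ℝ (traceForm A) v u u' - fderiv ℝ (traceForm A) v u' u := by
  rw [fderiv_traceForm hA, fderiv_traceForm hA, curvature, Matrix.trace_add, Matrix.trace_sub,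
    Matrix.trace_sub, Matrix.trace_mul_comm (A v u), sub_self, add_zero]

theorem trace_covDeriv (A : V → V →L[ℝ] Mat n) {ψ : V → Mat n} {v : V} (hψ : DifferentiableAt ℝ ψ v)
    (u : V) : (covDeriv A ψ v u).trace = fderiv ℝ (fun v => (ψ v).trace) v u := by
  have h : fderiv ℝ (fun v => (ψ v).trace) v = _ :=
    ((traceCLM n).hasFDerivAt.comp v hψ.hasFDerivAt).fderiv
  rw [h, covDeriv, Matrix.trace_add, Matrix.trace_sub, Matrix.trace_mul_comm (A v u), sub_self,
    add_zero]
  rfl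

theorem trace_unitary_conj {u : Mat n} (hu : u ∈ Matrix.unitaryGroup (Fin n) ℂ) (A : Mat n) :
    (u * A * u.conjTranspose).trace = A.trace := by
  rw [Matrix.trace_mul_cycle, show u.conjTranspose * u = 1 from (Unitary.mem_iff.mp hu).1, one_mul]

theorem norm_trace_le (A : Mat n) {M : ℝ} (h : ‖A‖ ≤ M) : ‖A.trace‖ ≤ ‖traceCLM n‖ * M :=
  ((traceCLM n).le_opNorm A).trans (mul_le_mul_of_nonneg_left h (norm_nonneg _))

end Trace

/-! ### The trace of the Higgs field as a global function. -/

section HiggsTrace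

variable {κ V B : Type*} [NormedAddCommGroup V] [NormedSpace ℝ V] [TopologicalSpace B]
  {P : Coords κ V B} {Y : Set B} {ι : Type*} {n : ℕ} {E : HermitianBundle P Y ι n}

theorem HermitianBundle.exists_mem_U (E : HermitianBundle P Y ι n) {p : B} (hp : p ∈ Y) :
    ∃ a, p ∈ E.U a := by
  rwa [← E.iUnion_U, mem_iUnion] at hp

open Classical in
/-- The trace of a Higgs field, a function on the base. -/
def HiggsField.traceFun (Φ : HiggsField E) (p : B) : ℂ :=
  if h : ∃ a, p ∈ E.U a then (Φ.φ h.choose p).trace else 0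

/-- Changing the frame conjugates `φ` by a unitary matrix, which preserves the trace. -/
theorem HiggsField.traceFun_eq (Φ : HiggsField E) {a : ι} {p : B} (hp : p ∈ E.U a) :
    Φ.traceFun p = (Φ.φ a p).trace := by
  have h : ∃ a, p ∈ E.U a := ⟨a, hp⟩
  rw [HiggsField.traceFun, dif_pos h, Φ.φ_gauge h.choose a p ⟨h.choose_spec, hp⟩,
    trace_unitary_conj (E.g_unitary _ _ p ⟨h.choose_spec, hp⟩)]

end HiggsTrace

/-! ### The trace of the Higgs field of a monopole is a punctured harmonic function. -/

section Monopole

variable {T : ℝ} {S : Type*} [TopologicalSpace S] [ChartedSpace ℂ S] {ι : Type*} {n : ℕ}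

theorem isOpen_over_product (e : HolChart S) {W : Set (AddCircle T × S)} (hW : IsOpen W) :
    IsOpen ((productCoords T S).over e W) :=
  isOpen_coordDom e (Ω := {p | ((p.1 : AddCircle T), p.2) ∈ W}) (hW.preimage
    (((AddCircle.continuous_mk' T).comp continuous_fst).prodMk continuous_snd))

theorem trace_hodgeStar (ρ : ℝ) (α : ℝ × ℂ → Mat n) (u u' : ℝ × ℂ) :
    (hodgeStar ρ α u u').trace =
      ((ρ * (u.2.re * u'.2.im - u.2.im * u'.2.re) : ℝ) : ℂ) * (α (1, 0)).trace
        + ((u.2.im * u'.1 - u.1 * u'.2.im : ℝ) : ℂ) * (α (0, 1)).trace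
        + ((u.1 * u'.2.re - u.2.re * u'.1 : ℝ) : ℂ) * (α (0, Complex.I)).trace := by
  simp only [hodgeStar, Matrix.trace_add, Matrix.trace_smul, Complex.real_smul]

variable {Y : Set (AddCircle T × S)} {E : HermitianBundle (productCoords T S) Y ι n}
  {g : HermitianMetric S} {C : ℝ} {D : Connection E} {Φ : HiggsField E}

theorem Connection.contDiffAt_pullForm (D : Connection E) {a : ι} {e : HolChart S} {q : ℝ × ℂ}
    (hq : q ∈ (productCoords T S).over e (E.U a)) :
    ContDiffAt ℝ ∞ (pullForm (productCoords T S) (D.A a) e) q :=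
  (D.A_smooth a e).contDiffAt ((isOpen_over_product e (E.isOpen_U a)).mem_nhds hq)

theorem HiggsField.contDiffAt_φ (Φ : HiggsField E) {a : ι} {e : HolChart S} {q : ℝ × ℂ}
    (hq : q ∈ (productCoords T S).over e (E.U a)) :
    ContDiffAt ℝ ∞ (fun q => Φ.φ a ((productCoords T S).param e q)) q :=
  (Φ.φ_smooth a e).contDiffAt ((isOpen_over_product e (E.isOpen_U a)).mem_nhds hq)

theorem HiggsField.inCoord_traceFun_eventuallyEq (Φ : HiggsField E) {a : ι} {e : HolChart S}
    {q : ℝ × ℂ} (hq : q ∈ (productCoords T S).over e (E.U a)) :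
    inCoord (liftFun Φ.traceFun) e =ᶠ[𝓝 q]
      fun q => (Φ.φ a ((productCoords T S).param e q)).trace := by
  filter_upwards [(isOpen_over_product e (E.isOpen_U a)).mem_nhds hq] with q' hq'
  exact Φ.traceFun_eq hq'.2

theorem HiggsField.contDiffAt_inCoord_traceFun (Φ : HiggsField E) {a : ι} {e : HolChart S}
    {q : ℝ × ℂ} (hq : q ∈ (productCoords T S).over e (E.U a)) :
    ContDiffAt ℝ ∞ (inCoord (liftFun Φ.traceFun) e) q :=
  ((traceCLM n).contDiff.contDiffAt.comp q (Φ.contDiffAt_φ hq)).congr_of_eventuallyEq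
    (Φ.inCoord_traceFun_eventuallyEq hq)

/-- The trace of the Bogomolny equation: `tr F - i C n ω = * d (tr φ)`. -/
theorem HEBogomolny.trace_eq (h : HEBogomolny g C D Φ) {a : ι} {e : HolChart S} {q : ℝ × ℂ}
    (hq : q ∈ (productCoords T S).over e (E.U a)) (u u' : ℝ × ℂ) :
    fderiv ℝ (traceForm (pullForm (productCoords T S) (D.A a) e)) q u u' -
        fderiv ℝ (traceForm (pullForm (productCoords T S) (D.A a) e)) q u' u -
        Complex.I * C * (areaForm (g.density e q.2) u u' : ℂ) * n =
      ((g.density e q.2 * (u.2.re * u'.2.im - u.2.im * u'.2.re) : ℝ) : ℂ) *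
          fderiv ℝ (inCoord (liftFun Φ.traceFun) e) q (1, 0)
        + ((u.2.im * u'.1 - u.1 * u'.2.im : ℝ) : ℂ) *
          fderiv ℝ (inCoord (liftFun Φ.traceFun) e) q (0, 1)
        + ((u.1 * u'.2.re - u.2.re * u'.1 : ℝ) : ℂ) *
          fderiv ℝ (inCoord (liftFun Φ.traceFun) e) q (0, Complex.I) := by
  have h1 := congrArg Matrix.trace (h a e q hq u u')
  rw [trace_hodgeStar, Matrix.trace_sub, Matrix.trace_smul,
    trace_curvature ((D.contDiffAt_pullForm hq).differentiableAt (by simp)), Matrix.trace_one] at h1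
  simp only [trace_covDeriv _ ((Φ.contDiffAt_φ hq).differentiableAt (by simp))] at h1
  rw [(Φ.inCoord_traceFun_eventuallyEq hq).fderiv_eq]
  simpa using h1

/-- Write `α = tr A`. By `HEBogomolny.trace_eq` the components of `dα` are, up to the `C` term, the
first derivatives of `tr φ`. The cyclic sum of the derivatives of these components is `ddα = 0`, by
symmetry of second derivatives, and it equals the Laplacian expression. -/
theorem HEBogomolny.harmonic (h : HEBogomolny g C D Φ) {a : ι} {e : HolChart S} {q : ℝ × ℂ}
    (hq : q ∈ (productCoords T S).over e (E.U a)) :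
    g.density e q.2 * fderiv ℝ (fderiv ℝ (inCoord (liftFun Φ.traceFun) e)) q (1, 0) (1, 0) +
      (fderiv ℝ (fderiv ℝ (inCoord (liftFun Φ.traceFun) e)) q (0, 1) (0, 1) +
        fderiv ℝ (fderiv ℝ (inCoord (liftFun Φ.traceFun) e)) q (0, Complex.I) (0, Complex.I)) = 0 := by
  set F := inCoord (liftFun Φ.traceFun) e with hF
  set α := traceForm (pullForm (productCoords T S) (D.A a) e) with hα
  have hopen := isOpen_over_product e (E.isOpen_U a) (T := T)
  have hαs : ContDiffAt ℝ ∞ α q := contDiffAt_const.clm_comp (D.contDiffAt_pullForm hq)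
  have hle : ((1 : WithTop ℕ∞) + 1) ≤ ∞ := by rw [one_add_one_eq_two]; exact ENat.LEInfty.out
  have hB := (hαs.fderiv_right (m := 1) hle).differentiableAt (by simp) |>.hasFDerivAt
  have hG := ((Φ.contDiffAt_inCoord_traceFun hq).fderiv_right (m := 1) hle).differentiableAt
    (by simp) |>.hasFDerivAt
  have hsymm : ∀ u v, fderiv ℝ (fderiv ℝ α) q u v = fderiv ℝ (fderiv ℝ α) q v u :=
    fun u v => (hαs.isSymmSndFDerivAt (by simpa using ENat.LEInfty.out)).eq u v
  -- derivatives along a line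
  have hline : ∀ v : ℝ × ℂ, HasDerivAt (fun s : ℝ => q + s • v) v 0 := fun v => by
    simpa using ((hasDerivAt_id (0 : ℝ)).smul_const v).const_add q
  have hmem : ∀ v : ℝ × ℂ, ∀ᶠ s : ℝ in 𝓝 0, q + s • v ∈ (productCoords T S).over e (E.U a) :=
    fun v => (hline v).continuousAt (by simpa using hopen.mem_nhds hq)
  have dα : ∀ v u u' : ℝ × ℂ, HasDerivAt (fun s : ℝ => fderiv ℝ α (q + s • v) u u' -
      fderiv ℝ α (q + s • v) u' u)
      (fderiv ℝ (fderiv ℝ α) q v u u' - fderiv ℝ (fderiv ℝ α) q v u' u) 0 := by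
    intro v u u'
    have h1 : HasDerivAt (fun s : ℝ => fderiv ℝ α (q + s • v)) (fderiv ℝ (fderiv ℝ α) q v) 0 :=
      HasFDerivAt.comp_hasDerivAt (f := fun s : ℝ => q + s • v) (l := fderiv ℝ α) 0
        (by simpa using hB) (hline v)
    have h2 : ∀ u u' : ℝ × ℂ, HasDerivAt (fun s : ℝ => fderiv ℝ α (q + s • v) u u')
        (fderiv ℝ (fderiv ℝ α) q v u u') 0 := fun u u' => by
      simpa using (h1.clm_apply (hasDerivAt_const 0 u)).clm_apply (hasDerivAt_const 0 u')
    exact (h2 u u').sub (h2 u' u)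
  have dF : ∀ v u : ℝ × ℂ, HasDerivAt (fun s : ℝ => fderiv ℝ F (q + s • v) u)
      (fderiv ℝ (fderiv ℝ F) q v u) 0 := by
    intro v u
    have h1 : HasDerivAt (fun s : ℝ => fderiv ℝ F (q + s • v)) (fderiv ℝ (fderiv ℝ F) q v) 0 :=
      HasFDerivAt.comp_hasDerivAt (f := fun s : ℝ => q + s • v) (l := fderiv ℝ F) 0
        (by simpa using hG) (hline v)
    simpa using h1.clm_apply (hasDerivAt_const 0 u)
  -- Moving along the time direction leaves the surface coordinate fixed, so the density and the `C`
  -- term are constant on this line. In `e2` and `e3` one vector is `(1, 0)`, so the area form does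
  -- not enter.
  have e1 : fderiv ℝ (fderiv ℝ α) q (1, 0) (0, 1) (0, Complex.I) -
      fderiv ℝ (fderiv ℝ α) q (1, 0) (0, Complex.I) (0, 1) =
      g.density e q.2 * fderiv ℝ (fderiv ℝ F) q (1, 0) (1, 0) := by
    refine (dα (1, 0) (0, 1) (0, Complex.I)).unique ((((dF (1, 0) (1, 0)).const_mul
      (g.density e q.2 : ℂ)).add_const
        (Complex.I * C * (g.density e q.2 : ℂ) * n)).congr_of_eventuallyEq ?_)
    filter_upwards [hmem (1, 0)] with s hs
    have := h.trace_eq hs (0, 1) (0, Complex.I)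
    simp [areaForm] at this
    simp
    linear_combination this
  have e2 : fderiv ℝ (fderiv ℝ α) q (0, 1) (0, Complex.I) (1, 0) -
      fderiv ℝ (fderiv ℝ α) q (0, 1) (1, 0) (0, Complex.I) =
      fderiv ℝ (fderiv ℝ F) q (0, 1) (0, 1) := by
    refine (dα (0, 1) (0, Complex.I) (1, 0)).unique ((dF (0, 1) (0, 1)).congr_of_eventuallyEq ?_)
    filter_upwards [hmem (0, 1)] with s hs
    simpa [areaForm] using h.trace_eq hs (0, Complex.I) (1, 0)
  have e3 : fderiv ℝ (fderiv ℝ α) q (0, Complex.I) (1, 0) (0, 1) -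
      fderiv ℝ (fderiv ℝ α) q (0, Complex.I) (0, 1) (1, 0) =
      fderiv ℝ (fderiv ℝ F) q (0, Complex.I) (0, Complex.I) := by
    refine (dα (0, Complex.I) (1, 0) (0, 1)).unique
      ((dF (0, Complex.I) (0, Complex.I)).congr_of_eventuallyEq ?_)
    filter_upwards [hmem (0, Complex.I)] with s hs
    simpa [areaForm] using h.trace_eq hs (1, 0) (0, 1)
  rw [← e1, ← e2, ← e3, hsymm (0, 1) (1, 0), hsymm (0, Complex.I) (1, 0),
    hsymm (0, Complex.I) (0, 1)]
  ring

theorem differentiableAt_radius_and_fderiv {t₀ : ℝ} {q : ℝ × ℂ} (hq : 0 < radius t₀ q) :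
    DifferentiableAt ℝ (radius t₀) q ∧
      fderiv ℝ (radius t₀) q (1, 0) = (q.1 - t₀) / radius t₀ q := by
  have hpos : 0 < (q.1 - t₀) ^ 2 + ‖q.2‖ ^ 2 := Real.sqrt_pos.mp hq
  have h1 : DifferentiableAt ℝ (radius t₀) q := by
    unfold radius
    refine DifferentiableAt.sqrt ?_ hpos.ne'
    exact ((differentiableAt_fst.sub_const t₀).pow 2).add (differentiableAt_snd.norm_sq ℝ)
  refine ⟨h1, ?_⟩
  have h2 : HasDerivAt (fun s => radius t₀ (s, q.2)) (fderiv ℝ (radius t₀) q (1, 0)) q.1 :=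
    HasFDerivAt.comp_hasDerivAt (f := fun s : ℝ => ((s, q.2) : ℝ × ℂ)) (l := radius t₀) q.1
      h1.hasFDerivAt (hasDerivAt_prodMk_left q.2 q.1)
  have h3 : HasDerivAt (fun s => radius t₀ (s, q.2)) ((q.1 - t₀) / radius t₀ q) q.1 := by
    have h4 : HasDerivAt (fun s => (s - t₀) ^ 2 + ‖q.2‖ ^ 2) (2 * (q.1 - t₀)) q.1 := by
      simpa using (((hasDerivAt_id q.1).sub_const t₀).pow 2).add_const (‖q.2‖ ^ 2)
    refine (h4.sqrt hpos.ne').congr_deriv ?_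
    rw [mul_div_mul_left _ _ two_ne_zero]
    rfl
  exact h2.unique h3

/-- The trace is bounded by the operator norm and is the same in every unitary trivialisation. The
derivative bound is the time component of `∇(R φ) = O(1)`, expanded by the product rule. -/
theorem DiracSingularity.exists_bounds {t₀ : ℝ} {z₀ : S} {k : Fin n → ℤ}
    (h : DiracSingularity g D Φ t₀ z₀ k) :
    ∃ e : HolChart S, z₀ ∈ e.1.source ∧ e.1 z₀ = 0 ∧ g.density e 0 = 1 ∧ ∃ c : ℝ, 0 < c ∧
      (∀ q ∈ puncturedBall t₀ c, q ∈ (productCoords T S).over e Y) ∧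
      ∃ M : ℝ, ∀ q ∈ puncturedBall t₀ c,
        ‖inCoord (liftFun Φ.traceFun) e q -
          Complex.I * ((∑ m, k m : ℤ) : ℂ) / (2 * radius t₀ q : ℝ)‖ ≤ M ∧
        ‖(radius t₀ q : ℂ) * fderiv ℝ (inCoord (liftFun Φ.traceFun) e) q (1, 0) +
          ((q.1 - t₀) / radius t₀ q : ℝ) * inCoord (liftFun Φ.traceFun) e q‖ ≤ M := by
  obtain ⟨e, hz, he, hρ, c, hc, hball, hZero, hPi, hT0, hTπ, -, M, m0, mπ, mc⟩ := h
  refine ⟨e, hz, he, hρ, c, hc, hball, ‖traceCLM n‖ * M, fun q hq => ?_⟩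
  obtain ⟨a, ha⟩ := E.exists_mem_U (hball q hq).2
  have hqa : q ∈ (productCoords T S).over e (E.U a) := ⟨(hball q hq).1, ha⟩
  have hF : inCoord (liftFun Φ.traceFun) e q = (Φ.φ a ((productCoords T S).param e q)).trace :=
    (Φ.inCoord_traceFun_eventuallyEq hqa).self_of_nhds
  have hconj : ∀ u : Mat n, u ∈ Matrix.unitaryGroup (Fin n) ℂ →
      (u * Φ.φ a ((productCoords T S).param e q) * u.conjTranspose
        - (Complex.I / (2 * radius t₀ q)) • Matrix.diagonal (fun m => (k m : ℂ))).trace =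
      inCoord (liftFun Φ.traceFun) e q - Complex.I * ((∑ m, k m : ℤ) : ℂ) / (2 * radius t₀ q : ℝ) := by
    intro u hu
    rw [Matrix.trace_sub, trace_unitary_conj hu, Matrix.trace_smul, Matrix.trace_diagonal, hF]
    push_cast
    rw [smul_eq_mul]
    ring
  constructor
  -- On the half-line `θ = 0` only the second trivialisation is available; elsewhere the first one
  -- serves.
  · by_cases hq0 : q.2 = 0 ∧ t₀ < q.1
    · have hqπ : q ∈ ballPi t₀ c := ⟨hq, fun h => absurd h.2 (not_lt.mpr hq0.2.le)⟩
      rw [← hconj _ (hTπ.unitary a q ⟨hqπ, hqa⟩)]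
      exact norm_trace_le _ (mπ a q ⟨hqπ, hqa⟩)
    · have hq0 : q ∈ ballZero t₀ c := ⟨hq, hq0⟩
      rw [← hconj _ (hT0.unitary a q ⟨hq0, hqa⟩)]
      exact norm_trace_le _ (m0 a q ⟨hq0, hqa⟩)
  · have h1 := norm_trace_le _ (mc a q ⟨hq, hqa⟩ (1, 0))
    obtain ⟨hr, hr'⟩ := differentiableAt_radius_and_fderiv hq.1
    have hφ := (Φ.contDiffAt_φ hqa).differentiableAt (by simp)
    have hFd := (Φ.contDiffAt_inCoord_traceFun hqa).differentiableAt (by simp)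
    have hs : DifferentiableAt ℝ
        (fun q' => radius t₀ q' • Φ.φ a ((productCoords T S).param e q')) q := hr.smul hφ
    rw [trace_covDeriv _ hs] at h1
    have h2 : (fun q' => (radius t₀ q' • Φ.φ a ((productCoords T S).param e q')).trace) =ᶠ[𝓝 q]
        fun q' => radius t₀ q' • inCoord (liftFun Φ.traceFun) e q' := by
      filter_upwards [Φ.inCoord_traceFun_eventuallyEq hqa] with q' hq'
      rw [hq', Matrix.trace_smul]
    rw [h2.fderiv_eq, fderiv_fun_smul hr hFd] at h1
    simp only [add_apply, smul_apply, ContinuousLinearMap.smulRight_apply, hr',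
      Complex.real_smul] at h1
    simpa using h1

variable {N : ℕ} {t : Fin N → ℝ} {z : Fin N → S} {k : Fin N → Fin n → ℤ}
  {E' : HermitianBundle (productCoords T S) (puncturedProduct T t z) ι n}
  {D' : Connection E'} {Φ' : HiggsField E'}

theorem IsHEMonopole.isPuncturedHarmonic [T2Space S] (h : IsHEMonopole g k C D' Φ') :
    IsPuncturedHarmonic g t z (fun j => ((∑ m, k j m : ℤ) : ℂ)) Φ'.traceFun where
  smooth e q hq := by
    obtain ⟨a, ha⟩ := E'.exists_mem_U hq.2
    exact (Φ'.contDiffAt_inCoord_traceFun ⟨hq.1, ha⟩).contDiffWithinAt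
  harmonic e q hq := by
    obtain ⟨a, ha⟩ := E'.exists_mem_U hq.2
    exact h.1.harmonic ⟨hq.1, ha⟩
  singular j := (h.2 j).exists_bounds

end Monopole

/-! ### Independence of the Chern-Weil integral from the connection. -/

section ChernWeil

variable {S : Type*} [TopologicalSpace S] [ChartedSpace ℂ S] [IsManifold 𝓘(ℂ) ω S]
  {ι : Type*} {n : ℕ} {E : HermitianBundle (surfaceCoords S) Set.univ ι n}

theorem mem_frameAt (E : HermitianBundle (surfaceCoords S) Set.univ ι n) (x : S) :
    x ∈ E.U (frameAt E x) :=
  Classical.choose_spec (Set.mem_iUnion.mp (E.iUnion_U.symm ▸ Set.mem_univ x : x ∈ ⋃ a, E.U a))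

theorem isOpen_over_surface (e : HolChart S) {W : Set S} (hW : IsOpen W) :
    IsOpen ((surfaceCoords S).over e W) :=
  e.1.continuousOn_symm.isOpen_inter_preimage e.1.open_target hW

theorem Connection.contDiffAt_pullForm_surface (D : Connection E) {a : ι} {e : HolChart S} {w : ℂ}
    (hw : w ∈ (surfaceCoords S).over e (E.U a)) :
    ContDiffAt ℝ ∞ (pullForm (surfaceCoords S) (D.A a) e) w :=
  (D.A_smooth a e).contDiffAt ((isOpen_over_surface e (E.isOpen_U a)).mem_nhds hw)

/-- The trace of a connection matrix, in a coordinate. -/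
def Connection.traceCoord (D : Connection E) (a : ι) (e : HolChart S) : ℂ → ℂ →L[ℝ] ℂ :=
  traceForm (pullForm (surfaceCoords S) (D.A a) e)

theorem Connection.contDiffAt_traceCoord (D : Connection E) {a : ι} {e : HolChart S} {w : ℂ}
    (hw : w ∈ (surfaceCoords S).over e (E.U a)) : ContDiffAt ℝ ∞ (D.traceCoord a e) w :=
  contDiffAt_const.clm_comp (D.contDiffAt_pullForm_surface hw)

/-- The inhomogeneous term `(dg) g⁻¹` of a gauge change is the same for both connections, so it
cancels in the difference. Hence `tr A - tr A'` is a global one-form. -/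
theorem Connection.traceCoord_sub (D D' : Connection E) {a b : ι} {e : HolChart S} {w : ℂ}
    (hw : w ∈ (surfaceCoords S).over e (E.U a ∩ E.U b)) :
    D.traceCoord a e w - D'.traceCoord a e w = D.traceCoord b e w - D'.traceCoord b e w := by
  ext1 u
  have hg : E.g a b ((surfaceCoords S).param e w) ∈ Matrix.unitaryGroup (Fin n) ℂ :=
    E.g_unitary a b _ hw.2
  have h1 := congrArg Matrix.trace (D.A_gauge a b e w hw u)
  have h2 := congrArg Matrix.trace (D'.A_gauge a b e w hw u)
  rw [Matrix.trace_sub, trace_unitary_conj hg] at h1 h2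
  change (pullForm (surfaceCoords S) (D.A a) e w u).trace -
    (pullForm (surfaceCoords S) (D'.A a) e w u).trace =
    (pullForm (surfaceCoords S) (D.A b) e w u).trace -
    (pullForm (surfaceCoords S) (D'.A b) e w u).trace
  rw [h1, h2]
  ring

theorem Connection.traceCoord_trans (D : Connection E) (a : ι) {e e' : HolChart S} {w : ℂ}
    (hw : w ∈ e.overlap e') :
    D.traceCoord a e w = (D.traceCoord a e' (e.trans e' w)).comp (fderiv ℝ (e.trans e') w) := by
  have h1 : pullForm (surfaceCoords S) (D.A a) e w =
      (pullForm (surfaceCoords S) (D.A a) e' (e.trans e' w)).comp (fderiv ℝ (e.trans e') w) := by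
    change (D.A a (e.1.symm w)).comp (e.diffSymm w) =
      ((D.A a (e'.1.symm (e.trans e' w))).comp (e'.diffSymm (e.trans e' w))).comp _
    rw [HolChart.symm_trans hw, HolChart.diffSymm_eq hw]
    rfl
  rw [traceCoord, traceForm, h1]
  rfl

/-- The trace of the difference of two connections. -/
def Connection.traceDiff (D D' : Connection E) : SmoothOneForm S where
  coord e w := D.traceCoord (frameAt E (e.1.symm w)) e w - D'.traceCoord (frameAt E (e.1.symm w)) e w
  smooth e w hw := by
    set a := frameAt E (e.1.symm w) with ha
    have hwa : w ∈ (surfaceCoords S).over e (E.U a) := ⟨hw, mem_frameAt E _⟩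
    refine (((D.contDiffAt_traceCoord hwa).sub
      (D'.contDiffAt_traceCoord hwa)).congr_of_eventuallyEq ?_).contDiffWithinAt
    filter_upwards [(isOpen_over_surface e (E.isOpen_U a)).mem_nhds hwa] with v hv
    exact D.traceCoord_sub D' ⟨hv.1, mem_frameAt E _, hv.2⟩
  compatible e e' w hw := by
    rw [D.traceCoord_trans _ hw, D'.traceCoord_trans _ hw, HolChart.symm_trans hw,
      ContinuousLinearMap.sub_comp]

theorem Connection.traceCurvature_eq (g : HermitianMetric S) (D : Connection E) (x : S) :
    traceCurvature g D x = curl (D.traceCoord (frameAt E x) (HolChart.at x)) ((HolChart.at x).1 x) /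
      g.density (HolChart.at x) ((HolChart.at x).1 x) := by
  have hx : x ∈ (HolChart.at x).1.source := mem_chart_source ℂ x
  have hw : (HolChart.at x).1 x ∈ (surfaceCoords S).over (HolChart.at x) (E.U (frameAt E x)) := by
    refine ⟨(HolChart.at x).1.map_source hx, ?_⟩
    change (HolChart.at x).1.symm ((HolChart.at x).1 x) ∈ _
    rw [(HolChart.at x).1.left_inv hx]
    exact mem_frameAt E x
  rw [traceCurvature, trace_curvature ((D.contDiffAt_pullForm_surface hw).differentiableAt (by simp))]
  rfl

theorem Connection.traceCurvature_sub (g : HermitianMetric S) (D D' : Connection E) (x : S) :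
    traceCurvature g D x = traceCurvature g D' x + (D.traceDiff D').curlDensity g x := by
  set e := HolChart.at x with he
  have hx : x ∈ e.1.source := mem_chart_source ℂ x
  set a := frameAt E x with ha
  have hw : e.1 x ∈ (surfaceCoords S).over e (E.U a) := by
    refine ⟨e.1.map_source hx, ?_⟩
    change e.1.symm (e.1 x) ∈ _
    rw [e.1.left_inv hx]
    exact mem_frameAt E x
  have h1 : (D.traceDiff D').coord e =ᶠ[𝓝 (e.1 x)] D.traceCoord a e - D'.traceCoord a e := by
    filter_upwards [(isOpen_over_surface e (E.isOpen_U a)).mem_nhds hw] with v hv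
    exact D.traceCoord_sub D' ⟨hv.1, mem_frameAt E _, hv.2⟩
  have h2 : curl (D.traceCoord a e - D'.traceCoord a e) (e.1 x) =
      curl (D.traceCoord a e) (e.1 x) - curl (D'.traceCoord a e) (e.1 x) := by
    have h3 : fderiv ℝ (D.traceCoord a e - D'.traceCoord a e) (e.1 x) = _ :=
      fderiv_sub ((D.contDiffAt_traceCoord hw).differentiableAt (by simp))
        ((D'.contDiffAt_traceCoord hw).differentiableAt (by simp))
    rw [curl, h3, curl, curl]
    simp only [sub_apply]
    ring
  rw [D.traceCurvature_eq, D'.traceCurvature_eq, SmoothOneForm.curlDensity, ← he, ← ha,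
    curl_congr h1, h2]
  ring

variable [T2Space S] [CompactSpace S] [MeasurableSpace S] [BorelSpace S]

/-- The Chern-Weil integral does not depend on the connection. -/
theorem Connection.chernIntegral_eq (g : HermitianMetric S) (D D' : Connection E)
    (hint : Integrable (traceCurvature g D') g.area) : chernIntegral g D = chernIntegral g D' := by
  have := g.isFiniteMeasure_area
  have h1 : ∫ x, traceCurvature g D x ∂g.area = ∫ x, traceCurvature g D' x ∂g.area := by
    simp_rw [D.traceCurvature_sub g D']
    rw [integral_add hint (((D.traceDiff D').continuous_curlDensity g).integrable_of_hasCompactSupport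
      (HasCompactSupport.of_compactSpace _)), SmoothOneForm.integral_curlDensity, add_zero]
  rw [chernIntegral, chernIntegral, h1]

/-- The definition picks some connection; this allows it to be replaced by the restriction of the
given one. -/
theorem firstChernNumber_eq (g : HermitianMetric S) (D : Connection E)
    (hint : Integrable (traceCurvature g D) g.area) : firstChernNumber g E = chernIntegral g D := by
  rw [firstChernNumber, dif_pos ⟨D⟩]
  exact Connection.chernIntegral_eq g _ D hint

end ChernWeil

/-! ### Restriction to the slice `{0} × S` and the degree formula. -/

section ZeroSlice

variable {T : ℝ} {S : Type*} [TopologicalSpace S] [ChartedSpace ℂ S]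
  {ι : Type*} {n : ℕ} {Y : Set (AddCircle T × S)} {E : HermitianBundle (productCoords T S) Y ι n}

theorem pullForm_zeroSlice (α : AddCircle T × S → (ℝ × ℂ) →L[ℝ] Mat n) (e : HolChart S) (w : ℂ) :
    pullForm (surfaceCoords S) (fun x => (α (0, x)).comp (ContinuousLinearMap.inr ℝ ℝ ℂ)) e w =
      (pullForm (productCoords T S) α e (0, w)).comp (ContinuousLinearMap.inr ℝ ℝ ℂ) := by
  ext1 u
  change α (0, e.1.symm w) (0, e.diffSymm w u) = α (((0 : ℝ) : AddCircle T), e.1.symm w)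
    ((ContinuousLinearMap.id ℝ ℝ).prodMap (e.diffSymm w) (0, u))
  simp

/-- The restriction of a connection to the slice `{0} × S`. -/
def Connection.zeroSlice (D : Connection E) (hY : ∀ x : S, ((0 : AddCircle T), x) ∈ Y) :
    Connection (E.zeroSlice hY) where
  A a x := (D.A a (0, x)).comp (ContinuousLinearMap.inr ℝ ℝ ℂ)
  A_smooth a e := by
    have h1 : pullForm (surfaceCoords S)
        (fun x => (D.A a (0, x)).comp (ContinuousLinearMap.inr ℝ ℝ ℂ)) e =
        fun w => (pullForm (productCoords T S) (D.A a) e (0, w)).comp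
          (ContinuousLinearMap.inr ℝ ℝ ℂ) := by
      ext1 w
      exact pullForm_zeroSlice _ e w
    rw [h1]
    have h2 := (D.A_smooth a e).comp (s := (surfaceCoords S).over e ((E.zeroSlice hY).U a))
      (f := fun w : ℂ => ((0 : ℝ), w)) (contDiff_const.prodMk contDiff_id).contDiffOn
      (fun w hw => ⟨hw.1, hw.2⟩)
    exact h2.clm_comp contDiffOn_const
  A_skew a x hx u := D.A_skew a (0, x) hx (0, u)
  A_gauge a b e w hw u := by
    have hq : ((0 : ℝ), w) ∈ (productCoords T S).over e (E.U a ∩ E.U b) := ⟨hw.1, hw.2⟩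
    have h1 := D.A_gauge a b e (0, w) hq (0, u)
    have h2 : DifferentiableAt ℝ (fun q => E.g a b ((productCoords T S).param e q)) (0, w) :=
      ((E.g_smooth a b e).contDiffAt ((isOpen_over_product e
        ((E.isOpen_U a).inter (E.isOpen_U b))).mem_nhds hq)).differentiableAt (by simp)
    have h3 : fderiv ℝ (fun w => (E.zeroSlice hY).g a b ((surfaceCoords S).param e w)) w u =
        fderiv ℝ (fun q => E.g a b ((productCoords T S).param e q)) (0, w) (0, u) := by
      have h4 : fderiv ℝ (fun w => E.g a b ((productCoords T S).param e (0, w))) w = _ :=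
        (HasFDerivAt.comp (f := fun w : ℂ => ((0 : ℝ), w)) w h2.hasFDerivAt
          (hasFDerivAt_prodMk_right (0 : ℝ) w)).fderiv
      exact congrArg (fun L => L u) h4
    rw [pullForm_zeroSlice, pullForm_zeroSlice, h3]
    exact h1

variable [IsManifold 𝓘(ℂ) ω S] {g : HermitianMetric S} {C : ℝ} {D : Connection E} {Φ : HiggsField E}

/-- On the slice `dt = 0`, and of the components of `*d(tr φ)` only the one with `*dt = ω` survives,
with coefficient `∂_t tr φ`. -/
theorem HEBogomolny.traceCurvature_zeroSlice (h : HEBogomolny g C D Φ)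
    (hY : ∀ x : S, ((0 : AddCircle T), x) ∈ Y) (x : S) :
    traceCurvature g (D.zeroSlice hY) x = timeDeriv (liftFun Φ.traceFun) (0, x) + Complex.I * C * n := by
  set e := HolChart.at x with he
  set a := frameAt (E.zeroSlice hY) x with ha
  have hx : x ∈ e.1.source := mem_chart_source ℂ x
  have ht := e.1.map_source hx
  have hxa : ((0 : AddCircle T), x) ∈ E.U a := mem_frameAt (E.zeroSlice hY) x
  have hq : ((0 : ℝ), e.1 x) ∈ (productCoords T S).over e (E.U a) := by
    refine ⟨ht, ?_⟩
    change (((0 : ℝ) : AddCircle T), e.1.symm (e.1 x)) ∈ _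
    rw [e.1.left_inv hx]
    exact hxa
  have h1 : (D.zeroSlice hY).traceCoord a e = fun w =>
      (traceForm (pullForm (productCoords T S) (D.A a) e) (0, w)).comp
        (ContinuousLinearMap.inr ℝ ℝ ℂ) := by
    ext1 w
    change (traceCLM n).comp (pullForm (surfaceCoords S) _ e w) = _
    rw [show (D.zeroSlice hY).A a = fun x => (D.A a (0, x)).comp (ContinuousLinearMap.inr ℝ ℝ ℂ)
      from rfl, pullForm_zeroSlice]
    rfl
  have h2 : DifferentiableAt ℝ (traceForm (pullForm (productCoords T S) (D.A a) e)) (0, e.1 x) :=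
    (contDiffAt_const.clm_comp (D.contDiffAt_pullForm hq)).differentiableAt (by simp)
  have h3 : ∀ u v, fderiv ℝ ((D.zeroSlice hY).traceCoord a e) (e.1 x) u v =
      fderiv ℝ (traceForm (pullForm (productCoords T S) (D.A a) e)) (0, e.1 x) (0, u) (0, v) := by
    intro u v
    have h4 := (HasFDerivAt.comp (f := fun w : ℂ => ((0 : ℝ), w)) (e.1 x) h2.hasFDerivAt
      (hasFDerivAt_prodMk_right (0 : ℝ) (e.1 x))).clm_comp
        (hasFDerivAt_const (ContinuousLinearMap.inr ℝ ℝ ℂ) (e.1 x))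
    rw [h1]
    have h5 : fderiv ℝ (fun w => (traceForm (pullForm (productCoords T S) (D.A a) e) (0, w)).comp
        (ContinuousLinearMap.inr ℝ ℝ ℂ)) (e.1 x) = _ := h4.fderiv
    rw [h5]
    simp
  have h6 : timeDeriv (liftFun Φ.traceFun) (0, x) =
      fderiv ℝ (inCoord (liftFun Φ.traceFun) e) (0, e.1 x) (1, 0) := by
    have h7 : HasDerivAt (fun s => inCoord (liftFun Φ.traceFun) e (s, e.1 x)) _ 0 :=
      HasFDerivAt.comp_hasDerivAt (f := fun s : ℝ => ((s, e.1 x) : ℝ × ℂ)) (0 : ℝ)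
        ((Φ.contDiffAt_inCoord_traceFun hq).differentiableAt (by simp)).hasFDerivAt
        (hasDerivAt_prodMk_left (e.1 x) 0)
    simp only [inCoord, e.1.left_inv hx] at h7
    exact h7.deriv
  have h8 := h.trace_eq hq (0, 1) (0, Complex.I)
  simp only [areaForm, Complex.one_re, Complex.I_im, Complex.one_im, Complex.I_re] at h8
  rw [Connection.traceCurvature_eq, div_eq_iff (g.density_ne_zero ht), curl, h3, h3, h6]
  norm_num at h8
  linear_combination h8

variable [T2Space S] [CompactSpace S] [MeasurableSpace S] [BorelSpace S] {N : ℕ} {t : Fin N → ℝ}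
  {z : Fin N → S} {k : Fin N → Fin n → ℤ} {E' : HermitianBundle (productCoords T S) (puncturedProduct T t z) ι n}
  {D' : Connection E'} {Φ' : HiggsField E'}

theorem IsHEMonopole.sum_eq (hT : 0 < T) (ht : ∀ j, t j ∈ Ioo 0 T)
    (hp : Function.Injective fun j => (t j, z j)) (h : IsHEMonopole g k C D' Φ') :
    ∑ j, ((∑ m, k j m : ℤ) : ℝ) * t j =
      T * (firstChernNumber g (E'.zeroSlice (zero_slice_mem ht z)) +
        C * n / (2 * Real.pi) * g.vol) := by
  have := g.isFiniteMeasure_area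
  have hf := h.isPuncturedHarmonic
  have hΩ := isOpen_puncturedCylinder (T := T) t z
  set G := ∫ x, timeDeriv (liftFun Φ'.traceFun) (0, x) ∂g.area with hG
  have hsum := hf.mul_integral_timeDeriv hT ht hp
  have hY := zero_slice_mem ht z
  have hcurv := h.1.traceCurvature_zeroSlice hY
  have hint : Integrable (fun x => timeDeriv (liftFun Φ'.traceFun) (0, x)) g.area :=
    (continuousOn_univ.mp ((hf.smooth.timeDeriv hΩ).continuousOn_slice hΩ
      fun x _ => hY x)).integrable_of_hasCompactSupport (HasCompactSupport.of_compactSpace _)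
  have hcurv' : traceCurvature g (D'.zeroSlice hY) =
      fun x => timeDeriv (liftFun Φ'.traceFun) (0, x) + Complex.I * C * n := funext hcurv
  have hint' : Integrable (traceCurvature g (D'.zeroSlice hY)) g.area := by
    rw [hcurv']
    exact hint.add (integrable_const _)
  rw [firstChernNumber_eq g (D'.zeroSlice hY) hint', chernIntegral, hcurv',
    integral_add hint (integrable_const _), integral_const, ← hG]
  change T * G = _ at hsum
  have hTC : (T : ℂ) ≠ 0 := Complex.ofReal_ne_zero.mpr hT.ne'
  have hpi : (Real.pi : ℂ) ≠ 0 := Complex.ofReal_ne_zero.mpr Real.pi_ne_zero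
  -- The complex Chern-Weil expression is shown to be a real number, so taking the real part in
  -- `chernIntegral` loses nothing.
  have h1 : Complex.I / (2 * Real.pi) * (G + g.area.real univ • (Complex.I * C * n)) =
      (((∑ j, ((∑ m, k j m : ℤ) : ℝ) * t j) / T - C * n / (2 * Real.pi) * g.vol : ℝ) : ℂ) := by
    have h2 : G = -(2 * Real.pi * Complex.I * ∑ j, ((∑ m, k j m : ℤ) : ℂ) * t j) / T := by
      rw [eq_div_iff hTC, mul_comm, hsum]
    rw [h2, Complex.real_smul, ← HermitianMetric.vol]
    push_cast
    field_simp
    ring_nf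
    simp only [Complex.I_sq]
    ring
  rw [h1, Complex.ofReal_re]
  field_simp
  ring

end ZeroSlice

end SingularMonopole

end

/-! ### The theorem. -/

theorem mainTheorem2 {T : ℝ} (hT : 0 < T)
    {S : Type*} [TopologicalSpace S] [T2Space S] [CompactSpace S] [ConnectedSpace S]
    [ChartedSpace ℂ S] [IsManifold 𝓘(ℂ) ω S] [MeasurableSpace S] [BorelSpace S]
    (g : SingularMonopole.HermitianMetric S)
    {N n : ℕ} (t : Fin N → ℝ) (ht : ∀ j, t j ∈ Set.Ioo 0 T) (z : Fin N → S)
    (hp : Function.Injective fun j => (t j, z j)) (k : Fin N → Fin n → ℤ)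
    {ι : Type*}
    (E : SingularMonopole.HermitianBundle (SingularMonopole.productCoords T S)
      (SingularMonopole.puncturedProduct T t z) ι n)
    (D : SingularMonopole.Connection E) (Φ : SingularMonopole.HiggsField E) :
    (SingularMonopole.IsMonopole g k D Φ →
      ∑ j, ((∑ m, k j m : ℤ) : ℝ) * t j =
        SingularMonopole.firstChernNumber g
          (E.zeroSlice (SingularMonopole.zero_slice_mem ht z)) * T) ∧
    (∀ C : ℝ, SingularMonopole.IsHEMonopole g k C D Φ →
      ∑ j, ((∑ m, k j m : ℤ) : ℝ) * t j =
        T * (SingularMonopole.firstChernNumber g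
            (E.zeroSlice (SingularMonopole.zero_slice_mem ht z))
          + C * n / (2 * Real.pi) * g.vol) ∧
      (0 < n →
        C = -(2 * Real.pi / g.vol) *
          ((SingularMonopole.firstChernNumber g
              (E.zeroSlice (SingularMonopole.zero_slice_mem ht z))
            - (∑ j, ((∑ m, k j m : ℤ) : ℝ) * t j) / T) / n))) := by
  refine ⟨fun h => ?_, fun C h => ?_⟩
  -- A monopole is an HE-monopole with constant `0`.
  · have h0 : SingularMonopole.IsHEMonopole g k 0 D Φ :=
      ⟨fun a e q hq u u' => by simpa using h.1 a e q hq u u', h.2⟩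
    rw [h0.sum_eq hT ht hp]
    ring
  · have h1 := h.sum_eq hT ht hp
    refine ⟨h1, fun hn => ?_⟩
    have hvol := g.vol_pos.ne'
    have hn' : (n : ℝ) ≠ 0 := Nat.cast_ne_zero.mpr hn.ne'
    have hT' := hT.ne'
    have hpi := Real.pi_ne_zero
    rw [h1]
    field_simp
    ring
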